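/- Let $X$ be a complex Hilbert space, let $A\in\mathcal B(X)$ be a self-adjoint Fredholm operator, and let $P$ be an orthogonal projection of $X$ with $\dim\ker P<\infty$. Put $\mathcal I(x,y)=\langle Ax,y\rangle$ for $x,y\in X$, $M=\operatorname{im}P$, and let $$N=\{x\in X:\ \mathcal I(x,y)=0\ \text{ for all } y\in M\}$$ be the $\mathcal I$-orthogonal complement of $M$. Then $N$ and $\ker\mathcal I=\ker A$ are finite-dimensional, the operator $A-PAP$ is compact, the segment $PAP+s(A-PAP)$, $0\le s\le 1$, is a curve of self-adjoint Fredholm operators (so that the relative Morse index $I(PAP,A)$ is defined), and $$I(PAP,A)=m^-(\mathcal I|_N)+\dim\ker(\mathcal I|_N)-\dim\ker\mathcal I .$$ Here $m^-(\mathcal I|_N)$ is the Morse index, i.e. the largest dimension of a subspace of $N$ on which $\mathcal I$ is negative definite, and $\ker(\mathcal I|_N)=\{x\in N:\mathcal I(x,y)=0\ \forall y\in N\}$; all dimensions are complex. For bounded self-adjoint Fredholm operators $A_0,A_1$ with $A_1-A_0$ compact, the relative Morse index is $I(A_0,A_1)=-\mathrm{sf}\{A_0+s(A_1-A_0);\,0\le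 s\le1\}$. The spectral flow of a norm-continuous curve $\{A_s\}_{0\le s\le1}$ of bounded self-adjoint Fredholm operators is the integer $$\mathrm{sf}\{A_s\}=\sum_{k=0}^{n-1}\Bigl(\dim\operatorname{im}P(A_{s_k},(-a_k,0))-\dim\operatorname{im}P(A_{s_{k+1}},(-a_k,0))\Bigr),$$ where $P(B,S)$ denotes the spectral projection of $B$ for $S$, and $0=s_0<\dots<s_n=1$ and $a_k>0$ are such that for every $k$ and every $s\in[s_k,s_{k+1}]$ one has $\pm a_k\notin\sigma(A_s)$ and $P(A_s,(-a_k,a_k))$ has finite rank; such choices exist and the sum does not depend on them. -/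

import Mathlib

noncomputable section

open Set

/-- The sesquilinear form `(x, y) ↦ ⟪A x, y⟫` of a bounded operator `A`. (Mathlib's inner product is
linear in the second argument, so this is the complex conjugate of the value in the convention
where it is linear in the first one; orthogonality, kernels and real parts are the same.) -/
def operatorForm {X : Type*} [NormedAddCommGroup X] [InnerProductSpace ℂ X] (A : X →L[ℂ] X) :
    X →ₗ⋆[ℂ] X →ₗ[ℂ] ℂ :=
  (innerₛₗ ℂ).comp (A : X →ₗ[ℂ] X)

theorem operatorForm_apply {X : Type*} [NormedAddCommGroup X] [InnerProductSpace ℂ X]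
    (A : X →L[ℂ] X) (x y : X) : operatorForm A x y = inner ℂ (A x) y := rfl

/-- The restriction of a sesquilinear form to a subspace. -/
def restrictForm {E : Type*} [AddCommGroup E] [Module ℂ E] (Q : E →ₗ⋆[ℂ] E →ₗ[ℂ] ℂ)
    (N : Submodule ℂ E) : N →ₗ⋆[ℂ] N →ₗ[ℂ] ℂ :=
  Q.domRestrict₁₂ N N

/-- The kernel `{x | Q x y = 0 for all y}` of a Hermitian form. -/
def formKer {E : Type*} [AddCommGroup E] [Module ℂ E] (Q : E →ₗ⋆[ℂ] E →ₗ[ℂ] ℂ) :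
    Submodule ℂ E :=
  LinearMap.ker Q

theorem mem_formKer {E : Type*} [AddCommGroup E] [Module ℂ E] (Q : E →ₗ⋆[ℂ] E →ₗ[ℂ] ℂ) (x : E) :
    x ∈ formKer Q ↔ ∀ y, Q x y = 0 := by
  simp [formKer, LinearMap.ext_iff]

/-- The Morse (negative) index `m⁻(Q)` of a Hermitian form: the largest dimension of a subspace on
which the form is negative definite (`⊤` if these dimensions are unbounded). -/
def morseIndex {E : Type*} [AddCommGroup E] [Module ℂ E] (Q : E →ₗ⋆[ℂ] E →ₗ[ℂ] ℂ) : ℕ∞ :=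
  ⨆ (V : Submodule ℂ E) (_ : FiniteDimensional ℂ V) (_ : ∀ x ∈ V, x ≠ 0 → (Q x x).re < 0),
    (Module.finrank ℂ V : ℕ∞)

section SpectralFlow

variable {X : Type*} [NormedAddCommGroup X] [InnerProductSpace ℂ X] [CompleteSpace X]

/-- The spectral projection `P(A, S)` of a bounded self-adjoint operator `A` for a set `S` of reals
such that `S ∩ σ(A)` is open and closed in `σ(A)` (so that the indicator function of `S` is
continuous on `σ(A)`). It agrees with the contour integral of the resolvent around `S ∩ σ(A)`.
It is only used for such sets below. -/
def spectralProjection (A : X →L[ℂ] X) (S : Set ℝ) : X →L[ℂ] X :=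
  cfc (S.indicator (fun _ => (1 : ℝ))) A

/-- The dimension of the range of the spectral projection `P(A, S)`, when this is finite. -/
def spectralDim (A : X →L[ℂ] X) (S : Set ℝ) : ℕ :=
  Module.finrank ℂ (spectralProjection A S).range

/-- A subdivision `0 = s₀ < s₁ < … < sₙ = 1` of the unit interval together with, for each `k < n`,
a window `(-aₖ, aₖ)` around `0`, such that for every `t ∈ [sₖ, sₖ₊₁]` the end points `±aₖ` are not
in the spectrum of `A t` and the spectral projection of `A t` for the window has finite rank (so
that the spectrum of `A t` in the window consists of finitely many eigenvalues of finite
multiplicity). Only the values of `s` at `0, …, n` and of `a` at `0, …, n - 1` matter. -/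
structure SpectralSubdivision (A : ℝ → X →L[ℂ] X) where
  n : ℕ
  s : ℕ → ℝ
  a : ℕ → ℝ
  s_zero : s 0 = 0
  s_last : s n = 1
  s_lt : ∀ k < n, s k < s (k + 1)
  a_pos : ∀ k < n, 0 < a k
  right_notMem : ∀ k < n, ∀ t ∈ Icc (s k) (s (k + 1)), a k ∉ spectrum ℝ (A t)
  left_notMem : ∀ k < n, ∀ t ∈ Icc (s k) (s (k + 1)), -a k ∉ spectrum ℝ (A t)
  finite_rank : ∀ k < n, ∀ t ∈ Icc (s k) (s (k + 1)),
    FiniteDimensional ℂ (spectralProjection (A t) (Ioo (-a k) (a k))).range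

/-- The sum `∑ₖ (dim im P(A_{sₖ}, (-aₖ, 0)) - dim im P(A_{sₖ₊₁}, (-aₖ, 0)))`, which counts the
eigenvalues that pass from the negative to the nonnegative half line. -/
def SpectralSubdivision.flow {A : ℝ → X →L[ℂ] X} (D : SpectralSubdivision A) : ℤ :=
  ∑ k ∈ Finset.range D.n,
    ((spectralDim (A (D.s k)) (Ioo (-D.a k) 0) : ℤ)
      - (spectralDim (A (D.s (k + 1))) (Ioo (-D.a k) 0) : ℤ))

/-- The family `A s`, `0 ≤ s ≤ 1`, is a norm continuous curve of bounded self-adjoint Fredholm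
operators whose spectral flow is well defined and equal to `m`: there is a subdivision as above,
and every such subdivision gives the value `m`. -/
structure HasSpectralFlow (A : ℝ → X →L[ℂ] X) (m : ℤ) : Prop where
  continuousOn : ContinuousOn A (Icc 0 1)
  isSelfAdjoint : ∀ t ∈ Icc (0 : ℝ) 1, IsSelfAdjoint (A t)
  isFredholm : ∀ t ∈ Icc (0 : ℝ) 1, (A t).IsFredholm
  nonempty : Nonempty (SpectralSubdivision A)
  flow_eq : ∀ D : SpectralSubdivision A, D.flow = m

/-- The relative Morse index `I(A₀, A₁)` is defined (that is, `A₁ - A₀` is compact and the segment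
from `A₀` to `A₁` has a spectral flow) and equal to `m`: it is minus the spectral flow of
`A₀ + s (A₁ - A₀)`, `0 ≤ s ≤ 1`. -/
structure HasRelativeMorseIndex (A₀ A₁ : X →L[ℂ] X) (m : ℤ) : Prop where
  isCompactOperator : IsCompactOperator (A₁ - A₀)
  hasSpectralFlow : HasSpectralFlow (fun s : ℝ => A₀ + (s : ℂ) • (A₁ - A₀)) (-m)

end SpectralFlow

end

/-!
The form of `A_t = PAP + t (A - PAP)` does not depend on `t` on the range of `P`, because
`P A_t P = B := PAP` for every `t`. Hence the positive spectral subspace `H₊` of `B` is a fixed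
closed subspace on which all the forms `⟪A_t x, x⟫` are uniformly positive. Since `A - PAP` has
finite rank, all `A_t` are Fredholm, and `H₊` has finite codimension in a maximal nonnegative
subspace of each of them.

*The flow.* For `c ≤ 0` outside the spectrum (or `c = 0`), the orthogonal projection `π` onto `H₊`
maps the spectral subspace of `[c, ∞)` onto `H₊`, by coercivity
(`surjOn_spectralProjection_Ici`). Let `κ_c(t)` be the dimension of the kernel of this surjection.
Then `κ_{-a} = κ_0 + dim im P(A_t, (-a, 0))` (`finrank_range_Ici_neg`), while `κ_{-a}` is constant
on an interval on which `-a` avoids the spectrum, since the dimension of the kernel is locally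
constant near a surjective operator (`finrank_range_inf_ker_const`). The sum defining the flow
telescopes, and for every subdivision its value is `κ_0(1) - κ_0(0)`
(`flow_eq_finrank_nonnegExcess`). A subdivision exists because `0` is isolated in the spectrum of
a self-adjoint Fredholm operator (`exists_hasSpectralGap`, `nonempty_spectralSubdivision`).

*Its value.* At `t = 0` the number `κ_0` is `dim ker B`. At `t = 1`, orthogonality to `H₊` may be
replaced by `A`-orthogonality without changing the dimension (`finrank_nonnegExcess_eq`). Let `R`
be the `A`-orthogonal complement of the range of `B`; it is a complement of that range, so that
`dim R = dim ker B`. Comparing with negative and nonnegative subspaces of `R` gives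
`κ_0(1) = dim R - m⁻(A|R)` (`finrank_nonneg_inf_add_le`, `finrank_le_nonneg_inf`), so the relative
Morse index is `m⁻(A|R)` (`hasRelativeMorseIndex_compression`).

*Finite dimensions.* `N` is the `A`-orthogonal complement in `R` of the isotropic subspace
`ker B ∩ im P`, and `ker (A|R) = ker A`. Therefore
`dim ker (A|N) = dim ker A + dim R - dim N` (`finrank_formKerOn_add`). The negative and the
positive index each drop by at most `dim R - dim N` on passing to `N`, and Sylvester's count of
dimensions forces both bounds to be equalities, which is
`m⁻(A|R) = m⁻(A|N) + dim ker (A|N) - dim ker A`.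
-/

open Set
open scoped Topology

/-! ### Spectral projections and spectral gaps -/

section SpectralSets

variable {X : Type*} [NormedAddCommGroup X] [InnerProductSpace ℂ X]
  {T : X →L[ℂ] X} {S S' : Set ℝ} {c : ℝ}

/-- `S ∩ σ(T)` is open and closed in `σ(T)`, stated as: membership in `S` is locally constant
on `σ(T)`. These are the sets `S` for which `spectralProjection T S` is meaningful. -/
def IsSpectralSet (T : X →L[ℂ] X) (S : Set ℝ) : Prop :=
  ∀ x ∈ spectrum ℝ T, ∀ᶠ y in 𝓝[spectrum ℝ T] x, y ∈ S ↔ x ∈ S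

theorem IsSpectralSet.continuousOn (h : IsSpectralSet T S) :
    ContinuousOn (S.indicator (fun _ => (1 : ℝ))) (spectrum ℝ T) := by
  intro x hx
  refine (continuousWithinAt_const (b := S.indicator (fun _ => (1 : ℝ)) x)).congr_of_eventuallyEq
    ?_ rfl
  filter_upwards [h x hx] with y hy
  by_cases hxS : x ∈ S <;> simp [hy, hxS]

theorem IsSpectralSet.inter (h : IsSpectralSet T S) (h' : IsSpectralSet T S') :
    IsSpectralSet T (S ∩ S') := fun x hx => by
  filter_upwards [h x hx, h' x hx] with y hy hy'
  simp [hy, hy']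

theorem IsSpectralSet.compl (h : IsSpectralSet T S) : IsSpectralSet T Sᶜ := fun x hx => by
  filter_upwards [h x hx] with y hy
  simp [hy]

theorem isSpectralSet_Ici_of_notMem (hc : c ∉ spectrum ℝ T) : IsSpectralSet T (Ici c) := by
  intro x hx
  have hne : x ≠ c := fun h => hc (h ▸ hx)
  refine nhdsWithin_le_nhds ?_
  rcases hne.lt_or_gt with h | h
  · filter_upwards [Iio_mem_nhds h] with y hy
    simp only [mem_Ici, mem_Iio] at *
    constructor <;> intro <;> linarith
  · filter_upwards [Ioi_mem_nhds h] with y hy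
    simp only [mem_Ici, mem_Ioi] at *
    constructor <;> intro <;> linarith

theorem IsSpectralSet.congr (h : IsSpectralSet T S)
    (hS : ∀ x ∈ spectrum ℝ T, x ∈ S ↔ x ∈ S') : IsSpectralSet T S' := fun x hx => by
  filter_upwards [h x hx, self_mem_nhdsWithin] with y hy hyσ
  rw [← hS y hyσ, ← hS x hx, hy]

theorem isSpectralSet_Ioo_of_notMem {a b : ℝ} (ha : a ∉ spectrum ℝ T) (hb : b ∉ spectrum ℝ T) :
    IsSpectralSet T (Ioo a b) := by
  refine ((isSpectralSet_Ici_of_notMem ha).inter (isSpectralSet_Ici_of_notMem hb).compl).congr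
    fun x hx => ?_
  have hne : x ≠ a := fun h => ha (h ▸ hx)
  simp [lt_iff_le_and_ne, hne.symm]

/-- The spectrum of `T` has no points in `(-ε, ε)` other than possibly `0`. -/
def HasSpectralGap (T : X →L[ℂ] X) (ε : ℝ) : Prop :=
  0 < ε ∧ ∀ x ∈ spectrum ℝ T, |x| < ε → x = 0

theorem HasSpectralGap.isSpectralSet_singleton {ε : ℝ} (h : HasSpectralGap T ε) :
    IsSpectralSet T {0} := by
  intro x hx
  by_cases h0 : x = 0
  · subst h0
    have : ∀ᶠ y in 𝓝[spectrum ℝ T] (0 : ℝ), |y| < ε :=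
      nhdsWithin_le_nhds (by
        have := (continuous_abs (G := ℝ)).tendsto 0
        rw [abs_zero] at this
        exact this.eventually_lt_const h.1)
    filter_upwards [this, self_mem_nhdsWithin] with y hy hyσ
    simp [h.2 y hyσ hy]
  · refine nhdsWithin_le_nhds ?_
    filter_upwards [isOpen_ne.mem_nhds h0] with y hy
    simp [show y ≠ 0 from hy, h0]

theorem HasSpectralGap.isSpectralSet_Ici {ε : ℝ} (h : HasSpectralGap T ε) :
    IsSpectralSet T (Ici 0) := by
  intro x hx
  by_cases h0 : x = 0
  · subst h0
    filter_upwards [h.isSpectralSet_singleton 0 hx] with y hy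
    simp only [mem_singleton_iff, iff_true] at hy
    simp [hy]
  · refine nhdsWithin_le_nhds ?_
    rcases lt_or_gt_of_ne h0 with h | h
    · filter_upwards [Iio_mem_nhds h] with y hy
      simp only [mem_Ici, mem_Iio] at *
      constructor <;> intro <;> linarith
    · filter_upwards [Ioi_mem_nhds h] with y hy
      simp only [mem_Ici, mem_Ioi] at *
      constructor <;> intro <;> linarith

theorem HasSpectralGap.isSpectralSet_Ioi {ε : ℝ} (h : HasSpectralGap T ε) :
    IsSpectralSet T (Ioi 0) :=
  (h.isSpectralSet_Ici.inter h.isSpectralSet_singleton.compl).congr fun x _ => by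
    simp [lt_iff_le_and_ne, eq_comm]

theorem HasSpectralGap.isSpectralSet_Iio {ε : ℝ} (h : HasSpectralGap T ε) :
    IsSpectralSet T (Iio 0) := by
  simpa using h.isSpectralSet_Ici.compl

variable [CompleteSpace X]

theorem isStarProjection_spectralProjection (h : IsSpectralSet T S) :
    IsStarProjection (spectralProjection T S) where
  isIdempotentElem := by
    have := h.continuousOn
    rw [IsIdempotentElem, spectralProjection, ← cfc_mul _ _ T]
    congr 1
    ext x
    by_cases hx : x ∈ S <;> simp [hx]
  isSelfAdjoint := IsSelfAdjoint.cfc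

theorem spectralProjection_mul (h : IsSpectralSet T S) (h' : IsSpectralSet T S') :
    spectralProjection T S * spectralProjection T S' = spectralProjection T (S ∩ S') := by
  have := h.continuousOn
  have := h'.continuousOn
  rw [spectralProjection, spectralProjection, ← cfc_mul _ _ T]
  unfold spectralProjection
  congr 1
  ext x
  by_cases hx : x ∈ S <;> by_cases hx' : x ∈ S' <;> simp [hx, hx']

theorem spectralProjection_congr (hS : ∀ x ∈ spectrum ℝ T, x ∈ S ↔ x ∈ S') :
    spectralProjection T S = spectralProjection T S' := by
  refine cfc_congr fun x hx => ?_
  by_cases hxS : x ∈ S'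
  · simp [hxS, (hS x hx).2 hxS]
  · simp [hxS, mt (hS x hx).1 hxS]

theorem spectralProjection_empty : spectralProjection T ∅ = 0 := by
  simp [spectralProjection]

theorem spectralProjection_add (h : IsSpectralSet T S) (h' : IsSpectralSet T S')
    (hd : Disjoint S S') :
    spectralProjection T S + spectralProjection T S' = spectralProjection T (S ∪ S') := by
  have := h.continuousOn
  have := h'.continuousOn
  rw [spectralProjection, spectralProjection, ← cfc_add (a := T) _ _]
  unfold spectralProjection
  congr 1
  ext x
  rw [indicator_union_of_disjoint hd]

theorem spectralProjection_compl (hT : IsSelfAdjoint T) (h : IsSpectralSet T S) :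
    spectralProjection T Sᶜ = 1 - spectralProjection T S := by
  rw [eq_sub_iff_add_eq', spectralProjection_add h h.compl disjoint_compl_right, union_compl_self,
    spectralProjection, indicator_univ]
  exact cfc_const_one ℝ T

theorem spectralProjection_commute (hT : IsSelfAdjoint T) (S : Set ℝ) :
    Commute T (spectralProjection T S) := by
  have := cfc_commute_cfc (id : ℝ → ℝ) (S.indicator fun _ => (1 : ℝ)) T
  rwa [cfc_id ℝ T] at this

theorem IsStarProjection.mem_range_iff {p : X →L[ℂ] X} (hp : IsStarProjection p) {x : X} :
    x ∈ p.range ↔ p x = x :=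
  ⟨fun ⟨y, hy⟩ => by
    rw [← hy]; exact congr($(hp.isIdempotentElem.eq) y), fun h => ⟨x, h⟩⟩

theorem IsStarProjection.inner_left {p : X →L[ℂ] X} (hp : IsStarProjection p) (x y : X) :
    inner ℂ (p x) y = inner ℂ x (p y) :=
  (ContinuousLinearMap.isSelfAdjoint_iff_isSymmetric.1 hp.isSelfAdjoint) x y

theorem inner_map_comm (hT : IsSelfAdjoint T) (x y : X) :
    inner ℂ (T x) y = inner ℂ x (T y) :=
  (ContinuousLinearMap.isSelfAdjoint_iff_isSymmetric.1 hT) x y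

theorem spectralProjection_affine_nonneg (hT : IsSelfAdjoint T) (h : IsSpectralSet T S) {α β : ℝ}
    (hαβ : ∀ x ∈ spectrum ℝ T, x ∈ S → 0 ≤ α * x + β) {v : X}
    (hv : v ∈ (spectralProjection T S).range) :
    0 ≤ α * (inner ℂ (T v) v).re + β * ‖v‖ ^ 2 := by
  have hcont := h.continuousOn
  have key : 0 ≤ ((α : ℂ) • T + (β : ℂ) • 1) * spectralProjection T S := by
    have e : ((α : ℂ) • T + (β : ℂ) • 1) * spectralProjection T S
        = cfc (fun x => (α * x + β) * S.indicator (fun _ => (1 : ℝ)) x) T := by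
      rw [cfc_mul _ _ T, cfc_add T _ _, cfc_const_mul α _ T, cfc_id' ℝ T, cfc_const β T,
        Algebra.algebraMap_eq_smul_one]
      rfl
    rw [e]
    refine cfc_nonneg fun x hx => ?_
    by_cases hxS : x ∈ S
    · simpa [hxS] using hαβ x hx hxS
    · simp [hxS]
  have h1 := ((ContinuousLinearMap.nonneg_iff_isPositive _).1 key).re_inner_nonneg_left v
  have e : (((α : ℂ) • T + (β : ℂ) • (1 : X →L[ℂ] X)) * spectralProjection T S) v
      = (α : ℂ) • T v + (β : ℂ) • v := by
    change ((α : ℂ) • T + (β : ℂ) • (1 : X →L[ℂ] X)) (spectralProjection T S v) = _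
    rw [(isStarProjection_spectralProjection h).mem_range_iff.1 hv]
    rfl
  rw [e, inner_add_left, inner_smul_left, inner_smul_left, inner_self_eq_norm_sq_to_K] at h1
  simpa [← Complex.ofReal_pow] using h1

/-- Spectral bound from below: `T ≥ c` on the spectral subspace of a subset of `[c, ∞)`. -/
theorem le_re_inner_of_mem_range (hT : IsSelfAdjoint T) (h : IsSpectralSet T S)
    (hc : ∀ x ∈ spectrum ℝ T, x ∈ S → c ≤ x) {v : X} (hv : v ∈ (spectralProjection T S).range) :
    c * ‖v‖ ^ 2 ≤ (inner ℂ (T v) v).re := by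
  have := spectralProjection_affine_nonneg hT h (α := 1) (β := -c)
    (fun x hx hxS => by linarith [hc x hx hxS]) hv
  linarith

/-- Spectral bound from above: `T ≤ c` on the spectral subspace of a subset of `(-∞, c]`. -/
theorem re_inner_le_of_mem_range (hT : IsSelfAdjoint T) (h : IsSpectralSet T S)
    (hc : ∀ x ∈ spectrum ℝ T, x ∈ S → x ≤ c) {v : X} (hv : v ∈ (spectralProjection T S).range) :
    (inner ℂ (T v) v).re ≤ c * ‖v‖ ^ 2 := by
  have := spectralProjection_affine_nonneg hT h (α := -1) (β := c)
    (fun x hx hxS => by linarith [hc x hx hxS]) hv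
  linarith

/-- The functional calculus of `x ↦ x⁻¹` (with `0⁻¹ = 0`) is a pseudo-inverse of `T` when `0` is
isolated in the spectrum. -/
theorem mul_cfc_inv (hT : IsSelfAdjoint T) (h : IsSpectralSet T {0}) :
    T * cfc (fun x : ℝ => x⁻¹) T = 1 - spectralProjection T {0} ∧
      cfc (fun x : ℝ => x⁻¹) T * T = 1 - spectralProjection T {0} := by
  have hinv : ContinuousOn (fun x : ℝ => x⁻¹) (spectrum ℝ T) := by
    intro x hx
    by_cases h0 : x = 0
    · subst h0
      refine (continuousWithinAt_const (b := (0 : ℝ)⁻¹)).congr_of_eventuallyEq ?_ rfl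
      filter_upwards [h 0 hx] with y hy
      simp_all
    · exact (continuousAt_inv₀ h0).continuousWithinAt
  have e : T * cfc (fun x : ℝ => x⁻¹) T = 1 - spectralProjection T {0} := by
    rw [← spectralProjection_compl hT h]
    nth_rw 1 [← cfc_id' ℝ T]
    rw [← cfc_mul _ _ T]
    refine cfc_congr fun x _ => ?_
    by_cases h0 : x = 0 <;> simp [h0]
  refine ⟨e, ?_⟩
  have hc := cfc_commute_cfc (id : ℝ → ℝ) (fun x : ℝ => x⁻¹) T
  rw [cfc_id ℝ T] at hc
  rw [← hc.eq, e]

/-- The kernel of `T` is the spectral subspace of `{0}`. -/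
theorem range_spectralProjection_singleton (hT : IsSelfAdjoint T) (h : IsSpectralSet T {0}) :
    (spectralProjection T {0}).range = T.ker := by
  have hcont := h.continuousOn
  have hP := isStarProjection_spectralProjection h
  ext x
  rw [hP.mem_range_iff]
  constructor
  · intro hx
    have e : T * spectralProjection T {0} = 0 := by
      nth_rw 1 [← cfc_id' ℝ T]
      rw [spectralProjection, ← cfc_mul _ _ T, ← cfc_const_zero ℝ T]
      refine cfc_congr fun x _ => ?_
      by_cases h0 : x = 0 <;> simp [h0]
    have := congr($e x)
    change T (spectralProjection T {0} x) = 0 at this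
    rwa [hx] at this
  · intro hx
    have := congr($((mul_cfc_inv hT h).2) x)
    change cfc (fun x : ℝ => x⁻¹) T (T x) = x - spectralProjection T {0} x at this
    rw [show T x = 0 from hx, map_zero] at this
    exact (sub_eq_zero.1 this.symm).symm

/-- A bounded below self-adjoint operator is invertible. -/
theorem isUnit_of_norm_le (hT : IsSelfAdjoint T) {c : ℝ} (hc : 0 < c)
    (h : ∀ x, c * ‖x‖ ^ 2 ≤ ‖T x‖ ^ 2) : IsUnit T := by
  have h2 : IsUnit (T * T) := by
    refine ContinuousLinearMap.isUnit_of_forall_le_norm_inner_map _ (c := ⟨c, hc.le⟩) hc fun x => ?_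
    change ‖x‖ ^ 2 * c ≤ ‖inner ℂ (T (T x)) x‖
    rw [inner_map_comm hT, inner_self_eq_norm_sq_to_K]
    simpa [mul_comm] using h x
  exact ((Commute.refl T).isUnit_mul_iff.1 h2).1

/-- `0` is isolated in the spectrum of a self-adjoint Fredholm operator. -/
theorem exists_hasSpectralGap (hT : IsSelfAdjoint T) (hF : T.IsFredholm) :
    ∃ ε, HasSpectralGap T ε := by
  set K := T.ker with hK
  have hKc : IsClosed (K : Set X) := T.isClosed_ker
  have : CompleteSpace K := hKc.completeSpace_coe
  -- `T` is bounded below on the orthogonal complement of its kernel.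
  obtain ⟨C, hC⟩ : ∃ C, AntilipschitzWith C (T ∘L Kᗮ.subtypeL) := by
    refine ContinuousLinearMap.antilipschitz_of_injective_of_isClosed_range _ ?_ ?_
    · refine (injective_iff_map_eq_zero _).2 fun x hx => ?_
      have h1 : (x : X) ∈ K := hx
      have h2 : (x : X) ∈ K ⊓ Kᗮ := ⟨h1, x.2⟩
      rw [Submodule.inf_orthogonal_eq_bot] at h2
      exact Subtype.ext h2
    · convert hF.isClosed_range using 1
      ext y
      constructor
      · rintro ⟨x, rfl⟩
        exact ⟨x, rfl⟩
      · rintro ⟨x, rfl⟩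
        obtain ⟨k, hk, y, hy, rfl⟩ := K.exists_add_mem_mem_orthogonal x
        refine ⟨⟨y, hy⟩, ?_⟩
        change T y = T (k + y)
        rw [map_add, show T k = 0 from hk, zero_add]
  have hb : ∀ y ∈ Kᗮ, ‖y‖ ≤ C * ‖T y‖ := fun y hy => by
    simpa using hC.le_mul_norm_sub ⟨y, hy⟩ 0
  refine ⟨((C : ℝ) + 1)⁻¹, by positivity, fun l hl hlt => ?_⟩
  by_contra h0
  refine hl ?_
  have hsa : IsSelfAdjoint (algebraMap ℝ (X →L[ℂ] X) l - T) :=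
    (IsSelfAdjoint.algebraMap _ (IsSelfAdjoint.all l)).sub hT
  set d : ℝ := ((C : ℝ) + 1)⁻¹ - |l| with hd
  have hdpos : 0 < d := sub_pos.2 hlt
  refine isUnit_of_norm_le hsa (c := min (l ^ 2) (d ^ 2)) (by positivity) fun x => ?_
  obtain ⟨k, hk, y, hy, rfl⟩ := K.exists_add_mem_mem_orthogonal x
  have hTk : T k = 0 := hk
  have hTy : T y ∈ Kᗮ := fun z hz => by
    rw [← inner_map_comm hT, show T z = 0 from hz, inner_zero_left]
  have e : (algebraMap ℝ (X →L[ℂ] X) l - T) (k + y) = (l : ℂ) • k + ((l : ℂ) • y - T y) := by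
    rw [Algebra.algebraMap_eq_smul_one]
    change (l : ℂ) • (k + y) - T (k + y) = _
    rw [map_add, hTk, smul_add]; abel
  have o1 : inner ℂ k y = 0 := hy k hk
  have o2 : inner ℂ ((l : ℂ) • k) ((l : ℂ) • y - T y) = 0 :=
    (Kᗮ.sub_mem (Kᗮ.smul_mem _ hy) hTy) _ (K.smul_mem _ hk)
  have n1 := norm_add_sq_eq_norm_sq_add_norm_sq_of_inner_eq_zero k y o1
  have n2 := norm_add_sq_eq_norm_sq_add_norm_sq_of_inner_eq_zero _ _ o2
  rw [← sq, ← sq, ← sq] at n1 n2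
  rw [e, n1, n2]
  have hbd : d * ‖y‖ ≤ ‖(l : ℂ) • y - T y‖ := by
    have h1 : ‖T y‖ - ‖(l : ℂ) • y‖ ≤ ‖(l : ℂ) • y - T y‖ := by
      rw [norm_sub_rev]; exact norm_sub_norm_le _ _
    have h2 : ((C : ℝ) + 1)⁻¹ * ‖y‖ ≤ ‖T y‖ := by
      rw [inv_mul_le_iff₀ (by positivity)]
      nlinarith [hb y hy, norm_nonneg (T y)]
    have h3 : ‖(l : ℂ) • y‖ = |l| * ‖y‖ := by simp [norm_smul]
    rw [hd, sub_mul]; linarith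
  have h3 : ‖(l : ℂ) • k‖ = |l| * ‖k‖ := by simp [norm_smul]
  have h4 : d ^ 2 * ‖y‖ ^ 2 ≤ ‖(l : ℂ) • y - T y‖ ^ 2 := by
    rw [← mul_pow]; exact pow_le_pow_left₀ (by positivity) hbd 2
  have h5 : min (l ^ 2) (d ^ 2) * ‖y‖ ^ 2 ≤ d ^ 2 * ‖y‖ ^ 2 := by gcongr; exact min_le_right _ _
  have h6 : min (l ^ 2) (d ^ 2) * ‖k‖ ^ 2 ≤ l ^ 2 * ‖k‖ ^ 2 := by gcongr; exact min_le_left _ _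
  have h7 : ‖(l : ℂ) • k‖ ^ 2 = l ^ 2 * ‖k‖ ^ 2 := by rw [h3, mul_pow, sq_abs]
  nlinarith

end SpectralSets

/-! ### Surjections and the dimension of their kernels -/

section Surjective

variable {X : Type*} [NormedAddCommGroup X] [InnerProductSpace ℂ X]

/-- If `P` and `p` are idempotents with `P p = p P = 0`, and `π` maps the range of `P` onto the
range of `π`, then passing from `range P` to `range (P + p)` increases the
dimension of the part lying in the kernel of `π` by the rank of `p`. -/
theorem finrank_range_add_inf_ker {P p π : X →L[ℂ] X} (hP : IsIdempotentElem P)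
    (hp : IsIdempotentElem p) (hPp : P * p = 0) (hpP : p * P = 0)
    (hsurj : ∀ z ∈ π.range, ∃ x ∈ P.range, π x = z)
    (hf : FiniteDimensional ℂ (P.range ⊓ π.ker : Submodule ℂ X))
    (hfp : FiniteDimensional ℂ p.range) :
    Module.finrank ℂ ((P + p).range ⊓ π.ker : Submodule ℂ X)
      = Module.finrank ℂ (P.range ⊓ π.ker : Submodule ℂ X) + Module.finrank ℂ p.range := by
  have hPP : ∀ x, P (P x) = P x := fun x => congr($(hP.eq) x)
  have hpp : ∀ x, p (p x) = p x := fun x => congr($(hp.eq) x)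
  have hPp' : ∀ x, P (p x) = 0 := fun x => congr($hPp x)
  have hpP' : ∀ x, p (P x) = 0 := fun x => congr($hpP x)
  have mem1 : ∀ x, x ∈ (P + p).range ↔ P x + p x = x := fun x =>
    ⟨fun ⟨y, hy⟩ => by
      rw [← hy]; change P (P y + p y) + p (P y + p y) = P y + p y
      simp [hPP, hpp, hPp', hpP'], fun h => ⟨x, h⟩⟩
  have mem0 : ∀ x, x ∈ P.range ↔ P x = x := fun x =>
    ⟨fun ⟨y, hy⟩ => by rw [← hy]; exact hPP y, fun h => ⟨x, h⟩⟩
  set K := ((P + p).range ⊓ π.ker : Submodule ℂ X) with hK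
  set K₀ := (P.range ⊓ π.ker : Submodule ℂ X) with hK₀
  let φ : K →ₗ[ℂ] p.range := ((p : X →ₗ[ℂ] X).rangeRestrict).comp K.subtype
  have hle : K₀ ≤ K := fun x hx => by
    refine ⟨(mem1 x).2 ?_, hx.2⟩
    have := (mem0 x).1 hx.1
    rw [← this, hPP, hpP', add_zero]
  have hker : φ.ker = K₀.comap K.subtype := by
    ext ⟨x, hx⟩
    have : φ ⟨x, hx⟩ = 0 ↔ p x = 0 := by
      rw [← Subtype.coe_inj]; rfl
    rw [LinearMap.mem_ker, this, Submodule.mem_comap]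
    change _ ↔ x ∈ K₀
    constructor
    · intro h
      refine ⟨(mem0 x).2 ?_, hx.2⟩
      have := (mem1 x).1 hx.1
      rwa [h, add_zero] at this
    · intro h
      rw [← (mem0 x).1 h.1, hpP']
  have hrange : φ.range = ⊤ := by
    rw [LinearMap.range_eq_top]
    rintro ⟨y, hy⟩
    obtain ⟨y', rfl⟩ := hy
    obtain ⟨x, hx, hxy⟩ := hsurj (π (p y')) ⟨_, rfl⟩
    refine ⟨⟨p y' - x, ?_, ?_⟩, ?_⟩
    · have hx := (mem0 x).1 hx
      refine (mem1 _).2 ?_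
      rw [map_sub, map_sub, hpp, hPp', ← hx, hpP', hPP]; abel
    · change π (p y' - x) = 0
      rw [map_sub, hxy, sub_self]
    · refine Subtype.ext ?_
      change p (p y' - x) = p y'
      rw [map_sub, hpp, ← (mem0 x).1 hx, hpP', sub_zero]
  have eK : φ.ker ≃ₗ[ℂ] K₀ := hker ▸ Submodule.comapSubtypeEquivOfLe hle
  have : FiniteDimensional ℂ φ.ker := eK.symm.finiteDimensional
  have : FiniteDimensional ℂ (K ⧸ φ.ker) := φ.quotKerEquivRange.symm.finiteDimensional
  have : FiniteDimensional ℂ K := Module.Finite.of_submodule_quotient φ.ker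
  rw [← φ.finrank_range_add_finrank_ker, hrange, finrank_top, eK.finrank_eq, add_comm]

variable [CompleteSpace X]

/-- A form that is coercive on the range of an orthogonal projection `π` can be inverted there
(Lax–Milgram). -/
theorem exists_inverse_of_coercive {π D : X →L[ℂ] X} (hπ : IsStarProjection π) {δ : ℝ}
    (hδ : 0 < δ) (h : ∀ z ∈ π.range, δ * ‖z‖ ^ 2 ≤ (inner ℂ (D z) z).re) :
    ∃ G : X →L[ℂ] X, ∀ z ∈ π.range, G z ∈ π.range ∧ π (D (G z)) = z := by
  have hππ : ∀ x, π (π x) = π x := fun x => congr($(hπ.isIdempotentElem.eq) x)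
  -- The compression of `D` is completed by the identity on the orthogonal complement.
  set C : X →L[ℂ] X := π * D * π + (1 - π) with hC
  have hCx : ∀ x, C x = π (D (π x)) + (x - π x) := fun x => rfl
  have hu : IsUnit C := by
    have hm : 0 < min δ 1 := by positivity
    refine ContinuousLinearMap.isUnit_of_forall_le_norm_inner_map _ (c := ⟨min δ 1, hm.le⟩) hm
      fun x => ?_
    refine le_trans ?_ (Complex.re_le_norm _)
    change ‖x‖ ^ 2 * min δ 1 ≤ _
    have h1 := h (π x) ⟨x, rfl⟩
    have o : inner ℂ (π x) (x - π x) = 0 := by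
      rw [hπ.inner_left, map_sub, hππ, sub_self, inner_zero_right]
    have o' : inner ℂ (x - π x) (π x) = 0 := by
      rw [← inner_conj_symm, o, map_zero]
    have hn := norm_add_sq_eq_norm_sq_add_norm_sq_of_inner_eq_zero _ _ o
    rw [add_sub_cancel, ← sq, ← sq, ← sq] at hn
    have e : inner ℂ (C x) x = inner ℂ (D (π x)) (π x) + inner ℂ (x - π x) (x - π x) := by
      rw [hCx, inner_add_left, hπ.inner_left]
      congr 1
      calc inner ℂ (x - π x) x = inner ℂ (x - π x) (π x + (x - π x)) := by rw [add_sub_cancel]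
        _ = _ := by rw [inner_add_right, o', zero_add]
    rw [e, Complex.add_re, inner_self_eq_norm_sq_to_K, hn]
    have e2 : (((‖x - π x‖ : ℝ) : ℂ) ^ 2).re = ‖x - π x‖ ^ 2 := by norm_cast
    have i1 : ‖π x‖ ^ 2 * min δ 1 ≤ ‖π x‖ ^ 2 * δ := by gcongr; exact min_le_left _ _
    have i2 : ‖x - π x‖ ^ 2 * min δ 1 ≤ ‖x - π x‖ ^ 2 * 1 := by gcongr; exact min_le_right _ _
    change _ ≤ _ + (((‖x - π x‖ : ℝ) : ℂ) ^ 2).re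
    rw [e2]
    linarith
  obtain ⟨u, hu⟩ := hu
  refine ⟨(↑u⁻¹ : X →L[ℂ] X), fun z hz => ?_⟩
  set w := (↑u⁻¹ : X →L[ℂ] X) z with hw
  have hCw : C w = z := by
    have := congr($(u.mul_inv) z)
    rwa [hu] at this
  have hz' : π z = z := hπ.mem_range_iff.1 hz
  rw [hCx] at hCw
  have h1 := congr(π $hCw)
  rw [map_add, hππ, map_sub, hππ, sub_self, add_zero, hz'] at h1
  rw [h1, add_eq_left, sub_eq_zero] at hCw
  exact ⟨hπ.mem_range_iff.2 hCw.symm, by rwa [← hCw] at h1⟩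

/-- The dimension of the kernel is locally constant near a surjective operator. -/
theorem eventually_finrank_ker_eq {F : Type*} [NormedAddCommGroup F] [NormedSpace ℂ F]
    [CompleteSpace F] (L₀ : X →L[ℂ] F) (h : Function.Surjective L₀) :
    ∀ᶠ L in 𝓝 L₀, Module.finrank ℂ L.ker = Module.finrank ℂ L₀.ker := by
  set K := L₀.ker with hK
  have hKc : IsClosed (K : Set X) := L₀.isClosed_ker
  have : CompleteSpace K := hKc.completeSpace_coe
  set q : X →L[ℂ] K := K.orthogonalProjectionOnto with hq
  -- Near `L₀` the map `x ↦ (L x, q x)` stays invertible.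
  let Φ : (X →L[ℂ] F) → (X →L[ℂ] F × K) := fun L => L.prod q
  have hΦ : Continuous Φ := by
    have : Φ = fun L => (ContinuousLinearMap.inl ℂ F K).comp L
        + (ContinuousLinearMap.inr ℂ F K).comp q := by
      ext L x <;> simp [Φ]
    rw [this]
    fun_prop
  have hbij : Function.Bijective (Φ L₀) := by
    constructor
    · refine (injective_iff_map_eq_zero _).2 fun x hx => ?_
      have h1 : L₀ x = 0 := congrArg Prod.fst hx
      have h2 : q x = 0 := congrArg Prod.snd hx
      have h3 : q ((⟨x, h1⟩ : K) : X) = ⟨x, h1⟩ :=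
        Submodule.orthogonalProjectionOnto_mem_subspace_eq_self _
      exact congrArg Subtype.val (h3.symm.trans h2)
    · rintro ⟨y, k⟩
      obtain ⟨x, rfl⟩ := h y
      refine ⟨x - q x + k, Prod.ext ?_ ?_⟩
      · change L₀ (x - q x + k) = L₀ x
        have h1 : L₀ (q x : X) = 0 := (q x).2
        have h2 : L₀ (k : X) = 0 := k.2
        rw [map_add, map_sub, h1, h2]; simp
      · change q (x - q x + k) = k
        rw [map_add, map_sub, hq, Submodule.orthogonalProjectionOnto_mem_subspace_eq_self,
          Submodule.orthogonalProjectionOnto_mem_subspace_eq_self]; simp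
  let e₀ : X ≃L[ℂ] F × K := ContinuousLinearEquiv.ofBijective (Φ L₀)
    (LinearMap.ker_eq_bot.2 hbij.1) (LinearMap.range_eq_top.2 hbij.2)
  have he₀ : (e₀ : X →L[ℂ] F × K) = Φ L₀ := by ext x <;> rfl
  have hn := e₀.nhds
  rw [he₀] at hn
  filter_upwards [hΦ.continuousAt.preimage_mem_nhds hn] with L hL
  obtain ⟨e, he⟩ := hL
  have hex : ∀ x, e x = (L x, q x) := fun x => congr($he x)
  refine (LinearEquiv.ofBijective ((q : X →ₗ[ℂ] K).domRestrict L.ker) ⟨?_, ?_⟩).finrank_eq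
  · refine (injective_iff_map_eq_zero _).2 fun x hx => ?_
    have h1 : L x = 0 := x.2
    have h2 : q x = 0 := hx
    refine Subtype.ext (e.injective ?_)
    rw [hex, h1, h2]; simp
  · intro k
    have h1 := hex (e.symm (0, k))
    rw [e.apply_symm_apply] at h1
    exact ⟨⟨e.symm (0, k), (congrArg Prod.fst h1).symm⟩, (congrArg Prod.snd h1).symm⟩

/-- Along a continuous family of projections `E t` and operators `Θ t` such that `π ∘ Θ t` maps the
range of `E t` onto the range of `π`, the kernel of this surjection has constant dimension. -/
theorem finrank_range_inf_ker_const {τ : Type*} [TopologicalSpace τ] [PreconnectedSpace τ]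
    {π : X →L[ℂ] X} (hπ : IsIdempotentElem π) {E Θ : τ → X →L[ℂ] X} (hE : Continuous E)
    (hΘ : Continuous Θ) (hidem : ∀ t, IsIdempotentElem (E t))
    (hsurj : ∀ t, ∀ z ∈ π.range, ∃ x ∈ (E t).range, π (Θ t x) = z) (s t : τ) :
    Module.finrank ℂ ((E s).range ⊓ (π * Θ s).ker : Submodule ℂ X)
      = Module.finrank ℂ ((E t).range ⊓ (π * Θ t).ker : Submodule ℂ X) := by
  refine IsLocallyConstant.apply_eq_of_preconnectedSpace
    (f := fun t => Module.finrank ℂ ((E t).range ⊓ (π * Θ t).ker : Submodule ℂ X))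
    ((IsLocallyConstant.iff_eventually_eq _).2 fun t₀ => ?_) s t
  have hEE : ∀ t x, E t (E t x) = E t x := fun t x => congr($((hidem t).eq) x)
  have memE : ∀ t x, x ∈ (E t).range ↔ E t x = x := fun t x =>
    ⟨fun ⟨y, hy⟩ => by rw [← hy]; exact hEE t y, fun h => ⟨x, h⟩⟩
  set F₁ := π.range with hF₁
  set F₂ := (1 - E t₀).range with hF₂
  have : CompleteSpace F₁ :=
    (ContinuousLinearMap.IsIdempotentElem.isClosed_range hπ).completeSpace_coe
  have : CompleteSpace F₂ :=
    (ContinuousLinearMap.IsIdempotentElem.isClosed_range (hidem t₀).one_sub).completeSpace_coe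
  let π' : X →L[ℂ] F₁ := π.codRestrict F₁ fun x => ⟨x, rfl⟩
  let q : X →L[ℂ] F₂ := (1 - E t₀).codRestrict F₂ fun x => ⟨x, rfl⟩
  let L : τ → (X →L[ℂ] F₁ × F₂) := fun t =>
    (ContinuousLinearMap.inl ℂ F₁ F₂).comp (π'.comp (Θ t * E t))
      + (ContinuousLinearMap.inr ℂ F₁ F₂).comp (q.comp (1 - E t))
  have hLc : Continuous L := by
    have h1 : Continuous fun t => Θ t * E t := hΘ.mul hE
    have h2 : Continuous fun t => 1 - E t := continuous_const.sub hE
    exact (continuous_const.clm_comp (continuous_const.clm_comp h1)).add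
      (continuous_const.clm_comp (continuous_const.clm_comp h2))
  have hπ' : ∀ x, (π' x : X) = π x := fun x => rfl
  have hq : ∀ x, (q x : X) = x - E t₀ x := fun x => rfl
  have hL1 : ∀ t x, ((L t x).1 : X) = π (Θ t (E t x)) := fun t x => by
    simp [L, hπ']
  have hL2 : ∀ t x, ((L t x).2 : X) = (x - E t x) - E t₀ (x - E t x) := fun t x => by
    simp only [L, add_apply, ContinuousLinearMap.comp_apply,
      ContinuousLinearMap.inl_apply, ContinuousLinearMap.inr_apply, Prod.snd_add, zero_add, hq]
    rfl
  have hker : ∀ t, ‖E t - E t₀‖ < 1 →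
      (L t).ker = ((E t).range ⊓ (π * Θ t).ker : Submodule ℂ X) := by
    intro t ht
    ext x
    constructor
    · intro hx
      have hx : L t x = 0 := hx
      have h1 := hL1 t x
      have h2 := hL2 t x
      rw [hx] at h1 h2
      have h1 : 0 = π (Θ t (E t x)) := h1
      have h2 : 0 = (x - E t x) - E t₀ (x - E t x) := h2
      -- A vector fixed by `1 - E t` and killed by `1 - E t₀` vanishes when these are close.
      have h3 : x - E t x = 0 := by
        by_contra hne
        have hy : (E t - E t₀) (x - E t x) = -(x - E t x) := by
          change E t (x - E t x) - E t₀ (x - E t x) = _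
          rw [map_sub (E t), hEE, sub_self, zero_sub, ← sub_eq_zero.1 h2.symm]
        have := (E t - E t₀).le_opNorm (x - E t x)
        rw [hy, norm_neg] at this
        have hpos : 0 < ‖x - E t x‖ := norm_pos_iff.2 hne
        nlinarith
      have h4 : E t x = x := (sub_eq_zero.1 h3).symm
      refine ⟨(memE t x).2 h4, ?_⟩
      rw [h4] at h1
      exact h1.symm
    · rintro ⟨hx1, hx2⟩
      have h4 : E t x = x := (memE t x).1 hx1
      have hx2 : π (Θ t x) = 0 := hx2
      refine Prod.ext (Subtype.ext ?_) (Subtype.ext ?_)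
      · change ((L t x).1 : X) = 0
        rw [hL1, h4, hx2]
      · change ((L t x).2 : X) = 0
        rw [hL2, h4]; simp
  have hsur : Function.Surjective (L t₀) := by
    rintro ⟨⟨z, hz⟩, ⟨y, hy⟩⟩
    obtain ⟨x, hx, hxz⟩ := hsurj t₀ z hz
    have hx := (memE t₀ x).1 hx
    have hy0 : E t₀ y = 0 := by
      obtain ⟨y', rfl⟩ := hy
      change E t₀ (y' - E t₀ y') = 0
      rw [map_sub, hEE, sub_self]
    refine ⟨x + y, Prod.ext (Subtype.ext ?_) (Subtype.ext ?_)⟩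
    · rw [hL1, map_add, hx, hy0, add_zero, hxz]
    · rw [hL2, map_add, hx, hy0, add_zero, add_sub_cancel_left, hy0, sub_zero]
  have hnear : ∀ᶠ t in 𝓝 t₀, ‖E t - E t₀‖ < 1 := by
    have : Filter.Tendsto (fun t => ‖E t - E t₀‖) (𝓝 t₀) (𝓝 ‖E t₀ - E t₀‖) :=
      ((hE.sub continuous_const).norm).tendsto t₀
    rw [sub_self, norm_zero] at this
    exact this.eventually_lt_const one_pos
  filter_upwards [hLc.continuousAt.eventually (eventually_finrank_ker_eq _ hsur), hnear]
    with t h1 h2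
  rw [hker t h2, hker t₀ (by simp)] at h1
  exact h1

end Surjective

/-! ### The spectral flow of a path that is positive on a fixed subspace -/

section Flow

variable {X : Type*} [NormedAddCommGroup X] [InnerProductSpace ℂ X] [CompleteSpace X]
  {T π : X →L[ℂ] X} {δ : ℝ}

/-- A self-adjoint operator and an orthogonal projection commuting with it split the form. -/
theorem inner_map_self_split {p : X →L[ℂ] X} (hp : IsStarProjection p) (hc : Commute T p)
    (x : X) : inner ℂ (T x) x
      = inner ℂ (T (p x)) (p x) + inner ℂ (T (x - p x)) (x - p x) := by
  have hpp : p (p x) = p x := congr($(hp.isIdempotentElem.eq) x)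
  have hcx : ∀ y, T (p y) = p (T y) := fun y => congr($(hc.eq) y)
  have o1 : inner ℂ (T (p x)) (x - p x) = 0 := by
    rw [hcx, hp.inner_left, map_sub, hpp, sub_self, inner_zero_right]
  have o2 : inner ℂ (T (x - p x)) (p x) = 0 := by
    rw [← hp.inner_left, ← hcx, map_sub, hpp, sub_self, map_zero, inner_zero_left]
  calc inner ℂ (T x) x = inner ℂ (T (p x + (x - p x))) (p x + (x - p x)) := by
        rw [add_sub_cancel]
    _ = _ := by rw [map_add, inner_add_left, inner_add_right, inner_add_right, o1, o2]; ring

theorem norm_sq_split {p : X →L[ℂ] X} (hp : IsStarProjection p) (x : X) :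
    ‖x‖ ^ 2 = ‖p x‖ ^ 2 + ‖x - p x‖ ^ 2 := by
  have h := inner_map_self_split hp (Commute.one_left p) x
  have h := congr(Complex.re $h)
  simpa [inner_self_eq_norm_sq_to_K, ← Complex.ofReal_pow] using h

theorem spectralProjection_sub_mem (hT : IsSelfAdjoint T) {S : Set ℝ} (h : IsSpectralSet T S)
    (x : X) : x - spectralProjection T S x ∈ (spectralProjection T Sᶜ).range := by
  rw [spectralProjection_compl hT h]
  exact ⟨x, rfl⟩

/-- If `T ≥ δ` on the range of `π`, the compression of `T - c` to the spectral subspace of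
`[c, ∞)`, `c ≤ 0`, is still coercive on the range of `π`, because `T - c ≤ 0` on the complementary
spectral subspace. -/
theorem coercive_spectralProjection_Ici (hT : IsSelfAdjoint T) {c : ℝ} (hc : c ≤ 0)
    (h : IsSpectralSet T (Ici c)) {z : X} (hz : δ * ‖z‖ ^ 2 ≤ (inner ℂ (T z) z).re) :
    δ * ‖z‖ ^ 2 ≤ (inner ℂ (T (spectralProjection T (Ici c) z))
      (spectralProjection T (Ici c) z)).re - c * ‖spectralProjection T (Ici c) z‖ ^ 2 := by
  have hp := isStarProjection_spectralProjection h
  have h1 := congr(Complex.re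
    $(inner_map_self_split hp (spectralProjection_commute hT (Ici c)) z))
  have h2 := norm_sq_split hp z
  have h3 := re_inner_le_of_mem_range hT h.compl (c := c)
    (fun x _ hx => by simp only [mem_compl_iff, mem_Ici, not_le] at hx; exact hx.le)
    (spectralProjection_sub_mem hT h z)
  rw [Complex.add_re] at h1
  have h4 : c * ‖z‖ ^ 2 ≤ 0 := mul_nonpos_of_nonpos_of_nonneg hc (by positivity)
  rw [h2] at h4
  linarith

/-- If `T` is positive on the range of `π`, then `π` maps the spectral subspace of `[c, ∞)`, `c ≤ 0`,
onto its range. -/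
theorem surjOn_spectralProjection_Ici (hT : IsSelfAdjoint T) (hπ : IsStarProjection π)
    (hδ : 0 < δ) (hcoer : ∀ z ∈ π.range, δ * ‖z‖ ^ 2 ≤ (inner ℂ (T z) z).re) {c : ℝ} (hc : c ≤ 0)
    (h : IsSpectralSet T (Ici c)) :
    ∀ z ∈ π.range, ∃ x ∈ (spectralProjection T (Ici c)).range, π x = z := by
  set p := spectralProjection T (Ici c) with hpdef
  have hp : IsStarProjection p := isStarProjection_spectralProjection h
  have hpp : ∀ x, p (p x) = p x := fun x => congr($(hp.isIdempotentElem.eq) x)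
  have hcx : ∀ y, T (p y) = p (T y) := fun y => congr($((spectralProjection_commute hT _).eq) y)
  obtain ⟨G, hG⟩ := exists_inverse_of_coercive (D := T * p - (c : ℂ) • p) hπ hδ fun z hz => by
    refine (coercive_spectralProjection_Ici hT hc h (hcoer z hz)).trans_eq ?_
    rw [← hpdef]
    have e : (T * p - (c : ℂ) • p) z = p (T (p z) - (c : ℂ) • p z) := by
      rw [map_sub, map_smul, hpp, ← hcx, hpp]; rfl
    rw [e, hp.inner_left, inner_sub_left, inner_smul_left, inner_self_eq_norm_sq_to_K]
    simp [← Complex.ofReal_pow]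
  intro z hz
  refine ⟨p (T (p (G z)) - (c : ℂ) • p (G z)), ⟨_, rfl⟩, ?_⟩
  rw [map_sub p, map_smul, hpp, ← hcx, hpp]
  exact (hG z hz).2

/-- The part of the nonnegative spectral subspace of `T` orthogonal to the range of `π`. When
`T` is positive on the range of `π`, its dimension measures the size of the nonnegative spectral
subspace relative to the range of `π`. -/
noncomputable def nonnegExcess (π T : X →L[ℂ] X) : Submodule ℂ X :=
  (spectralProjection T (Ici 0)).range ⊓ π.ker

/-- Enlarging the spectral subspace of `[0, ∞)` to that of `[-a, ∞)` adds the dimension of the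
spectral subspace of `(-a, 0)` to the excess. -/
theorem finrank_range_Ici_neg (hT : IsSelfAdjoint T) (hπ : IsStarProjection π)
    (hδ : 0 < δ) (hcoer : ∀ z ∈ π.range, δ * ‖z‖ ^ 2 ≤ (inner ℂ (T z) z).re) {ε a : ℝ}
    (hgap : HasSpectralGap T ε) (ha : 0 < a) (har : a ∉ spectrum ℝ T) (hal : -a ∉ spectrum ℝ T)
    (hfin : FiniteDimensional ℂ (spectralProjection T (Ioo (-a) a)).range)
    (hK : FiniteDimensional ℂ (nonnegExcess π T)) :
    Module.finrank ℂ ((spectralProjection T (Ici (-a))).range ⊓ π.ker : Submodule ℂ X)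
      = Module.finrank ℂ (nonnegExcess π T) + spectralDim T (Ioo (-a) 0) := by
  have h0 := hgap.isSpectralSet_Ici
  have hI : IsSpectralSet T (Ioo (-a) 0) :=
    ((isSpectralSet_Ici_of_notMem hal).inter h0.compl).congr fun x hx => by
      have hne : x ≠ -a := fun h => hal (h ▸ hx)
      simp [lt_iff_le_and_ne, hne.symm]
  have hW := isSpectralSet_Ioo_of_notMem hal har
  have hd : Disjoint (Ici (0 : ℝ)) (Ioo (-a) 0) :=
    Set.disjoint_left.2 fun x hx hx' => absurd hx'.2 (not_lt.2 hx)
  have e1 : spectralProjection T (Ici 0) + spectralProjection T (Ioo (-a) 0)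
      = spectralProjection T (Ici (-a)) := by
    rw [spectralProjection_add h0 hI hd]
    refine spectralProjection_congr fun x hx => ?_
    have hne : x ≠ -a := fun h => hal (h ▸ hx)
    simp only [mem_union, mem_Ici, mem_Ioo]
    constructor
    · rintro (h | h)
      · linarith
      · exact h.1.le
    · intro h
      rcases le_or_gt 0 x with h' | h'
      · exact Or.inl h'
      · exact Or.inr ⟨lt_of_le_of_ne h hne.symm, h'⟩
  rw [← e1]
  refine finrank_range_add_inf_ker (isStarProjection_spectralProjection h0).isIdempotentElem
    (isStarProjection_spectralProjection hI).isIdempotentElem ?_ ?_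
    (surjOn_spectralProjection_Ici hT hπ hδ hcoer le_rfl h0) hK ?_
  · rw [spectralProjection_mul h0 hI, hd.inter_eq, spectralProjection_empty]
  · rw [spectralProjection_mul hI h0, hd.symm.inter_eq, spectralProjection_empty]
  · refine Submodule.finiteDimensional_of_le (S₂ := (spectralProjection T (Ioo (-a) a)).range) ?_
    rintro _ ⟨y, rfl⟩
    refine ⟨spectralProjection T (Ioo (-a) 0) y, ?_⟩
    have e := spectralProjection_mul hW hI
    rw [inter_eq_right.2 (Ioo_subset_Ioo_right ha.le)] at e
    exact congr($e y)

/-- The spectral projection of a set `S` depends continuously on the operator as long as the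
spectrum avoids the boundary of `S`. -/
theorem continuousOn_spectralProjection {τ : Type*} [TopologicalSpace τ] {A : τ → X →L[ℂ] X}
    {V : Set τ} {S F : Set ℝ} (hF : IsClosed F) (hSF : frontier S ⊆ F) (hA : ContinuousOn A V)
    (hsa : ∀ t ∈ V, IsSelfAdjoint (A t)) (h : ∀ t ∈ V, ∀ x ∈ F, x ∉ spectrum ℝ (A t)) :
    ContinuousOn (fun t => spectralProjection (A t) S) V := by
  refine ContinuousOn.cfc_of_mem_nhdsSet (s := Fᶜ) _ ?_ hA hsa ?_
  · refine hF.isOpen_compl.mem_nhdsSet.2 (iUnion₂_subset fun t ht x hx hxF => h t ht x hxF hx)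
  · intro x hx
    refine ContinuousAt.continuousWithinAt ?_
    have hxf : x ∉ frontier S := fun hxS => hx (hSF hxS)
    by_cases hxS : x ∈ S
    · have : S ∈ 𝓝 x := by
        rw [mem_frontier_iff_notMem_interior hxS, not_not] at hxf
        exact mem_interior_iff_mem_nhds.1 hxf
      refine (continuousAt_const (y := (1 : ℝ))).congr ?_
      filter_upwards [this] with y hy
      simp [hy]
    · have : Sᶜ ∈ 𝓝 x := by
        rw [← frontier_compl, mem_frontier_iff_notMem_interior hxS, not_not] at hxf
        exact mem_interior_iff_mem_nhds.1 hxf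
      refine (continuousAt_const (y := (0 : ℝ))).congr ?_
      filter_upwards [this] with y hy
      rw [indicator_of_notMem hy]

/-- The spectral flow of a path which is uniformly positive on the range of a fixed projection is
the variation of the excess of the nonnegative spectral subspace. -/
theorem flow_eq_finrank_nonnegExcess {A : ℝ → X →L[ℂ] X} (hπ : IsStarProjection π) (hδ : 0 < δ)
    (hA : ContinuousOn A (Icc 0 1)) (hsa : ∀ t ∈ Icc (0 : ℝ) 1, IsSelfAdjoint (A t))
    (hgap : ∀ t ∈ Icc (0 : ℝ) 1, ∃ ε, HasSpectralGap (A t) ε)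
    (hcoer : ∀ t ∈ Icc (0 : ℝ) 1, ∀ z ∈ π.range, δ * ‖z‖ ^ 2 ≤ (inner ℂ (A t z) z).re)
    (hfin : ∀ t ∈ Icc (0 : ℝ) 1, FiniteDimensional ℂ (nonnegExcess π (A t)))
    (D : SpectralSubdivision A) :
    D.flow = (Module.finrank ℂ (nonnegExcess π (A 1)) : ℤ)
      - Module.finrank ℂ (nonnegExcess π (A 0)) := by
  have hmono : ∀ j ≤ D.n, ∀ i ≤ j, D.s i ≤ D.s j := by
    intro j
    induction j with
    | zero => intro _ i hi; rw [Nat.le_zero.1 hi]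
    | succ j ih =>
      intro hj i hi
      rcases Nat.le_succ_iff.1 hi with h | h
      · exact (ih (by omega) i h).trans (D.s_lt j (by omega)).le
      · rw [h]
  have hmem : ∀ j ≤ D.n, D.s j ∈ Icc (0 : ℝ) 1 := fun j hj =>
    ⟨D.s_zero ▸ hmono j hj 0 (Nat.zero_le _), D.s_last ▸ hmono D.n le_rfl j hj⟩
  have hstep : ∀ k ∈ Finset.range D.n,
      ((spectralDim (A (D.s k)) (Ioo (-D.a k) 0) : ℤ)
        - (spectralDim (A (D.s (k + 1))) (Ioo (-D.a k) 0) : ℤ))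
      = (Module.finrank ℂ (nonnegExcess π (A (D.s (k + 1)))) : ℤ)
        - Module.finrank ℂ (nonnegExcess π (A (D.s k))) := by
    intro k hk
    have hk : k < D.n := Finset.mem_range.1 hk
    have hle := (D.s_lt k hk).le
    have hsub : Icc (D.s k) (D.s (k + 1)) ⊆ Icc 0 1 :=
      Icc_subset_Icc (hmem k hk.le).1 (hmem (k + 1) hk).2
    have hw : ∀ t ∈ Icc (D.s k) (D.s (k + 1)),
        Module.finrank ℂ ((spectralProjection (A t) (Ici (-D.a k))).range ⊓ π.ker : Submodule ℂ X)
          = Module.finrank ℂ (nonnegExcess π (A t)) + spectralDim (A t) (Ioo (-D.a k) 0) := by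
      intro t ht
      obtain ⟨ε, hε⟩ := hgap t (hsub ht)
      exact finrank_range_Ici_neg (hsa t (hsub ht)) hπ hδ (hcoer t (hsub ht)) hε (D.a_pos k hk)
        (D.right_notMem k hk t ht) (D.left_notMem k hk t ht) (D.finite_rank k hk t ht)
        (hfin t (hsub ht))
    have hcont : ContinuousOn (fun t => spectralProjection (A t) (Ici (-D.a k)))
        (Icc (D.s k) (D.s (k + 1))) := by
      refine continuousOn_spectralProjection (F := {-D.a k}) isClosed_singleton ?_ (hA.mono hsub)
        (fun t ht => hsa t (hsub ht)) ?_
      · rw [frontier_Ici]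
      · rintro t ht x rfl
        exact D.left_notMem k hk t ht
    have := Subtype.preconnectedSpace (isPreconnected_Icc (a := D.s k) (b := D.s (k + 1)))
    have hconst := finrank_range_inf_ker_const (τ := Icc (D.s k) (D.s (k + 1)))
      hπ.isIdempotentElem (E := fun t => spectralProjection (A t) (Ici (-D.a k)))
      (Θ := fun _ => 1) hcont.domRestrict continuous_const
      (fun t => (isStarProjection_spectralProjection
        (isSpectralSet_Ici_of_notMem (D.left_notMem k hk t t.2))).isIdempotentElem)
      (fun t => surjOn_spectralProjection_Ici (hsa t (hsub t.2)) hπ hδ (hcoer t (hsub t.2))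
        (neg_nonpos.2 (D.a_pos k hk).le)
        (isSpectralSet_Ici_of_notMem (D.left_notMem k hk t t.2)))
      ⟨D.s k, left_mem_Icc.2 hle⟩ ⟨D.s (k + 1), right_mem_Icc.2 hle⟩
    rw [show π * (1 : X →L[ℂ] X) = π from mul_one π] at hconst
    rw [hw _ (left_mem_Icc.2 hle), hw _ (right_mem_Icc.2 hle)] at hconst
    omega
  rw [SpectralSubdivision.flow, Finset.sum_congr rfl hstep,
    Finset.sum_range_sub (fun k => (Module.finrank ℂ (nonnegExcess π (A (D.s k))) : ℤ)),
    D.s_zero, D.s_last]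

end Flow

/-! ### Existence of subdivisions -/

section Existence

variable {X : Type*} [NormedAddCommGroup X] [InnerProductSpace ℂ X]

/-- A projection close to one of finite rank has finite rank. -/
theorem finiteDimensional_range_of_norm_sub_lt {p q : X →L[ℂ] X} (hp : IsIdempotentElem p)
    (hq : FiniteDimensional ℂ q.range) (h : ‖p - q‖ < 1) : FiniteDimensional ℂ p.range := by
  have hpp : ∀ x ∈ p.range, p x = x := by
    rintro _ ⟨y, rfl⟩
    exact congr($(hp.eq) y)
  refine FiniteDimensional.of_injective
    ((q : X →ₗ[ℂ] X).rangeRestrict.domRestrict p.range) ?_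
  refine (injective_iff_map_eq_zero _).2 fun x hx => ?_
  have hx : q x = 0 := congrArg Subtype.val hx
  by_contra hne
  have h1 := (p - q).le_opNorm x
  have h2 : (p - q) (x : X) = x := by
    change p x - q x = x
    rw [hx, sub_zero, hpp x x.2]
  rw [h2] at h1
  have hpos : 0 < ‖(x : X)‖ := norm_pos_iff.2 fun h => hne (Subtype.ext h)
  nlinarith

variable [CompleteSpace X]

/-- Near each parameter of a continuous path of self-adjoint Fredholm operators, one window
`(-a, a)` is admissible. -/
theorem exists_local_window {A : ℝ → X →L[ℂ] X} {I : Set ℝ} (hA : ContinuousOn A I)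
    (hsa : ∀ t ∈ I, IsSelfAdjoint (A t)) (hF : ∀ t ∈ I, (A t).IsFredholm) {x : ℝ} (hx : x ∈ I) :
    ∃ a > 0, ∀ᶠ t in 𝓝[I] x, a ∉ spectrum ℝ (A t) ∧ -a ∉ spectrum ℝ (A t) ∧
      FiniteDimensional ℂ (spectralProjection (A t) (Ioo (-a) a)).range := by
  obtain ⟨ε, hε, hgap⟩ := exists_hasSpectralGap (hsa x hx) (hF x hx)
  have ha : 0 < ε / 2 := by positivity
  refine ⟨ε / 2, ha, ?_⟩
  set a := ε / 2 with hadef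
  have haε : |a| < ε := by rw [abs_of_pos ha]; linarith
  have hout : ∀ c ≠ 0, |c| < ε → ∀ᶠ t in 𝓝[I] x, c ∉ spectrum ℝ (A t) := by
    intro c hc hcε
    have h1 : IsUnit (algebraMap ℝ (X →L[ℂ] X) c - A x) :=
      not_not.1 fun h => hc (hgap c h hcε)
    have h2 : ContinuousWithinAt (fun t => algebraMap ℝ (X →L[ℂ] X) c - A t) I x :=
      continuousWithinAt_const.sub (hA x hx)
    filter_upwards [h2.preimage_mem_nhdsWithin (Units.isOpen.mem_nhds h1)] with t ht hs
    exact hs ht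
  set V := {t ∈ I | a ∉ spectrum ℝ (A t) ∧ -a ∉ spectrum ℝ (A t)} with hV
  have hVmem : ∀ᶠ t in 𝓝[I] x, t ∈ V := by
    filter_upwards [hout a ha.ne' haε, hout (-a) (neg_ne_zero.2 ha.ne') (by rwa [abs_neg]),
      self_mem_nhdsWithin] with t h1 h2 h3
    exact ⟨h3, h1, h2⟩
  have hxV : x ∈ V := mem_of_mem_nhdsWithin hx hVmem
  have hcont : ContinuousOn (fun t => spectralProjection (A t) (Ioo (-a) a)) V := by
    refine continuousOn_spectralProjection (F := {-a, a}) (Set.toFinite _).isClosed ?_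
      (hA.mono fun t ht => ht.1) (fun t ht => hsa t ht.1) ?_
    · rw [frontier_Ioo (by linarith)]
    · rintro t ht y (rfl | rfl)
      · exact ht.2.2
      · exact ht.2.1
  have hnear : ∀ᶠ t in 𝓝[I] x, ‖spectralProjection (A t) (Ioo (-a) a)
      - spectralProjection (A x) (Ioo (-a) a)‖ < 1 := by
    have h1 := (hcont x hxV).sub (continuousWithinAt_const
      (b := spectralProjection (A x) (Ioo (-a) a)))
    have h2 : Filter.Tendsto (fun t => ‖spectralProjection (A t) (Ioo (-a) a)
      - spectralProjection (A x) (Ioo (-a) a)‖) (𝓝[V] x) (𝓝 ‖spectralProjection (A x) (Ioo (-a) a)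
      - spectralProjection (A x) (Ioo (-a) a)‖) := h1.norm
    rw [sub_self, norm_zero] at h2
    have h3 := h2.eventually_lt_const one_pos
    have hle : 𝓝[I] x ≤ 𝓝[V] x := nhdsWithin_le_iff.2 hVmem
    exact hle h3
  have hfin : FiniteDimensional ℂ (spectralProjection (A x) (Ioo (-a) a)).range := by
    have e : spectralProjection (A x) (Ioo (-a) a) = spectralProjection (A x) {0} := by
      refine spectralProjection_congr fun y hy => ⟨fun h => ?_, fun h => ?_⟩
      · exact hgap y hy ((abs_lt.2 h).trans (by linarith))
      · rw [mem_singleton_iff.1 h]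
        exact ⟨by linarith, ha⟩
    rw [e, range_spectralProjection_singleton (hsa x hx)
      (HasSpectralGap.isSpectralSet_singleton ⟨hε, hgap⟩)]
    exact (hF x hx).finite_ker
  filter_upwards [hVmem, hnear] with t ht hn
  exact ⟨ht.2.1, ht.2.2, finiteDimensional_range_of_norm_sub_lt
    (isStarProjection_spectralProjection
      (isSpectralSet_Ioo_of_notMem ht.2.2 ht.2.1)).isIdempotentElem hfin hn⟩

theorem nonempty_spectralSubdivision {A : ℝ → X →L[ℂ] X} (hA : ContinuousOn A (Icc 0 1))
    (hsa : ∀ t ∈ Icc (0 : ℝ) 1, IsSelfAdjoint (A t))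
    (hF : ∀ t ∈ Icc (0 : ℝ) 1, (A t).IsFredholm) : Nonempty (SpectralSubdivision A) := by
  choose a ha hloc using fun x : Icc (0 : ℝ) 1 => exists_local_window hA hsa hF x.2
  have hloc' : ∀ x : Icc (0 : ℝ) 1, ∃ r > 0, ∀ t ∈ Metric.ball (x : ℝ) r ∩ Icc 0 1,
      a x ∉ spectrum ℝ (A t) ∧ -a x ∉ spectrum ℝ (A t) ∧
        FiniteDimensional ℂ (spectralProjection (A t) (Ioo (-a x) (a x))).range := fun x =>
    Metric.mem_nhdsWithin_iff.1 (hloc x)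
  choose r hr hball using hloc'
  obtain ⟨δ, hδ, hleb⟩ := lebesgue_number_lemma_of_metric (s := Icc (0 : ℝ) 1)
    (c := fun x : Icc (0 : ℝ) 1 => Metric.ball (x : ℝ) (r x)) isCompact_Icc
    (fun x => Metric.isOpen_ball)
    (fun x hx => mem_iUnion.2 ⟨⟨x, hx⟩, Metric.mem_ball_self (hr _)⟩)
  obtain ⟨m, hm⟩ := exists_nat_one_div_lt hδ
  set n : ℕ := m + 1 with hn
  have hn0 : (0 : ℝ) < n := by positivity
  have hnδ : 1 / (n : ℝ) < δ := by rw [hn]; exact_mod_cast hm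
  have hstep : ∀ k : ℕ, ((k + 1 : ℕ) : ℝ) / n = k / n + 1 / n := fun k => by
    push_cast; ring
  have hchoice : ∀ k : ℕ, ∃ x : Icc (0 : ℝ) 1, k < n →
      Icc ((k : ℝ) / n) (((k + 1 : ℕ) : ℝ) / n) ⊆ Metric.ball (x : ℝ) (r x) ∩ Icc 0 1 := by
    intro k
    by_cases hk : k < n
    · have h1 : (k : ℝ) / n ∈ Icc (0 : ℝ) 1 :=
        ⟨by positivity, (div_le_one hn0).2 (by exact_mod_cast hk.le)⟩
      obtain ⟨x, hx⟩ := hleb _ h1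
      refine ⟨x, fun _ t ht => ⟨hx ?_, h1.1.trans ht.1, ht.2.trans ?_⟩⟩
      · rw [Metric.mem_ball, Real.dist_eq, abs_of_nonneg (sub_nonneg.2 ht.1)]
        have := ht.2
        rw [hstep] at this
        linarith
      · exact (div_le_one hn0).2 (by exact_mod_cast hk)
    · exact ⟨⟨0, by simp⟩, fun h => absurd h hk⟩
  choose x hx using hchoice
  exact ⟨{
    n := n
    s := fun k => (k : ℝ) / n
    a := fun k => a (x k)
    s_zero := by simp
    s_last := div_self hn0.ne'
    s_lt := fun k _ => by
      rw [hstep]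
      have : 0 < 1 / (n : ℝ) := by positivity
      linarith
    a_pos := fun k _ => ha _
    right_notMem := fun k hk t ht => (hball _ t (hx k hk ht)).1
    left_notMem := fun k hk t ht => (hball _ t (hx k hk ht)).2.1
    finite_rank := fun k hk t ht => (hball _ t (hx k hk ht)).2.2 }⟩

end Existence

/-! ### Operators with a given compression -/

section Compression

variable {X : Type*} [NormedAddCommGroup X] [InnerProductSpace ℂ X] [CompleteSpace X]
  {A B P T : X →L[ℂ] X} {ε : ℝ}

/-- The nonzero spectral part of `B = P T P` lies in the range of `P`. -/
theorem compression_absorb (hB : IsSelfAdjoint B) (hgap : HasSpectralGap B ε)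
    (hP : IsStarProjection P) (hPT : P * T * P = B) :
    P * (1 - spectralProjection B {0}) = 1 - spectralProjection B {0} ∧
      (1 - spectralProjection B {0}) * P = 1 - spectralProjection B {0} := by
  obtain ⟨h1, h2⟩ := mul_cfc_inv hB hgap.isSpectralSet_singleton
  have hPP : P * P = P := hP.isIdempotentElem.eq
  have hPB : P * B = B := by rw [← hPT, ← mul_assoc, ← mul_assoc, hPP]
  have hBP : B * P = B := by rw [← hPT, mul_assoc, hPP]
  constructor
  · rw [← h1, ← mul_assoc, hPB]
  · rw [← h2, mul_assoc, hBP]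

theorem inner_compression (hP : IsStarProjection P) (hPT : P * T * P = B) {x y : X}
    (hx : P x = x) (hy : P y = y) : inner ℂ (T x) y = inner ℂ (B x) y := by
  have e : B x = P (T (P x)) := congr($hPT.symm x)
  rw [e, hP.inner_left, hx, hy]

theorem compression_fixed (hB : IsSelfAdjoint B) (hgap : HasSpectralGap B ε)
    (hP : IsStarProjection P) (hPT : P * T * P = B) {x : X}
    (hx : spectralProjection B {0} x = 0) : P x = x := by
  have h := congr($((compression_absorb hB hgap hP hPT).1) x)
  change P (x - spectralProjection B {0} x) = x - spectralProjection B {0} x at h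
  rwa [hx, sub_zero] at h

theorem spectralProjection_apply_eq_zero {S S' : Set ℝ} (h : IsSpectralSet B S)
    (h' : IsSpectralSet B S') (hd : Disjoint S S') {x : X}
    (hx : x ∈ (spectralProjection B S').range) : spectralProjection B S x = 0 := by
  obtain ⟨y, rfl⟩ := hx
  have e := spectralProjection_mul h h'
  rw [hd.inter_eq, spectralProjection_empty] at e
  exact congr($e y)

theorem disjoint_zero_pos : Disjoint ({0} : Set ℝ) (Ioi 0) := by simp
theorem disjoint_zero_neg : Disjoint ({0} : Set ℝ) (Iio 0) := by simp

/-- `B` is bounded below by the spectral gap on its positive spectral subspace, and any `T` with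
the same compression `P T P = B` agrees with `B` there. -/
theorem coercive_of_compression (hB : IsSelfAdjoint B) (hgap : HasSpectralGap B ε)
    (hP : IsStarProjection P) (hPT : P * T * P = B) :
    ∀ z ∈ (spectralProjection B (Ioi 0)).range, ε * ‖z‖ ^ 2 ≤ (inner ℂ (T z) z).re := by
  intro z hz
  have hz' := compression_fixed hB hgap hP hPT (spectralProjection_apply_eq_zero
    hgap.isSpectralSet_singleton hgap.isSpectralSet_Ioi disjoint_zero_pos hz)
  rw [inner_compression hP hPT hz' hz']
  refine le_re_inner_of_mem_range hB hgap.isSpectralSet_Ioi (fun x hx hx0 => ?_) hz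
  by_contra h
  have hx0 : 0 < x := hx0
  exact hx0.ne' (hgap.2 x hx (by rw [abs_of_pos hx0]; linarith))

theorem re_inner_le_neg_gap (hB : IsSelfAdjoint B) (hgap : HasSpectralGap B ε) {x : X}
    (hx : x ∈ (spectralProjection B (Iio 0)).range) :
    (inner ℂ (B x) x).re ≤ -ε * ‖x‖ ^ 2 := by
  refine re_inner_le_of_mem_range hB hgap.isSpectralSet_Iio (fun x hx hx0 => ?_) hx
  by_contra h
  have hx0 : x < 0 := hx0
  exact hx0.ne (hgap.2 x hx (by rw [abs_of_neg hx0]; linarith))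

theorem negative_of_compression (hB : IsSelfAdjoint B) (hgap : HasSpectralGap B ε)
    (hP : IsStarProjection P) (hPT : P * T * P = B) {x : X}
    (hx : x ∈ (spectralProjection B (Iio 0)).range) :
    (inner ℂ (T x) x).re ≤ -ε * ‖x‖ ^ 2 := by
  have hx' := compression_fixed hB hgap hP hPT (spectralProjection_apply_eq_zero
    hgap.isSpectralSet_singleton hgap.isSpectralSet_Iio disjoint_zero_neg hx)
  rw [inner_compression hP hPT hx' hx']
  exact re_inner_le_neg_gap hB hgap hx

theorem spectralProjection_Ici_eq (hgap : HasSpectralGap B ε) :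
    spectralProjection B (Ici 0) = spectralProjection B (Ioi 0) + spectralProjection B {0} := by
  rw [spectralProjection_add hgap.isSpectralSet_Ioi hgap.isSpectralSet_singleton
    disjoint_zero_pos.symm]
  congr 1
  ext x
  simp [le_iff_lt_or_eq, eq_comm, or_comm]

theorem mem_range_Iio_of_eq_zero (hB : IsSelfAdjoint B) (hgap : HasSpectralGap B ε) {x : X}
    (h1 : spectralProjection B (Ioi 0) x = 0) (h0 : spectralProjection B {0} x = 0) :
    x ∈ (spectralProjection B (Iio 0)).range := by
  have e := spectralProjection_compl hB hgap.isSpectralSet_Ici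
  rw [compl_Ici, spectralProjection_Ici_eq hgap] at e
  refine ⟨x, ?_⟩
  change spectralProjection B (Iio 0) x = x
  rw [e]
  change x - (spectralProjection B (Ioi 0) x + spectralProjection B {0} x) = x
  rw [h1, h0]; simp

theorem re_inner_nonneg_of_mem_Ici (hT : IsSelfAdjoint T) {η : ℝ} (hgap : HasSpectralGap T η)
    {x : X} (hx : x ∈ (spectralProjection T (Ici 0)).range) : 0 ≤ (inner ℂ (T x) x).re := by
  simpa using le_re_inner_of_mem_range hT hgap.isSpectralSet_Ici (c := 0) (fun _ _ h => h) hx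

/-- The excess is finite-dimensional: it meets the negative part of `B` trivially, and hence
projects injectively to the kernel of `B`. -/
theorem finiteDimensional_nonnegExcess (hB : IsSelfAdjoint B) (hgap : HasSpectralGap B ε)
    (hP : IsStarProjection P) (hPT : P * T * P = B) (hBk : FiniteDimensional ℂ B.ker)
    (hT : IsSelfAdjoint T) {η : ℝ} (hgapT : HasSpectralGap T η) :
    FiniteDimensional ℂ (nonnegExcess (spectralProjection B (Ioi 0)) T) := by
  rw [← range_spectralProjection_singleton hB hgap.isSpectralSet_singleton] at hBk
  refine FiniteDimensional.of_injective
    ((spectralProjection B {0} : X →ₗ[ℂ] X).rangeRestrict.domRestrict (nonnegExcess _ T)) ?_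
  refine (injective_iff_map_eq_zero _).2 fun x hx => ?_
  have hx : spectralProjection B {0} x = 0 := congrArg Subtype.val hx
  have h1 := negative_of_compression hB hgap hP hPT (mem_range_Iio_of_eq_zero hB hgap x.2.2 hx)
  have h2 := re_inner_nonneg_of_mem_Ici hT hgapT x.2.1
  have h3 : ‖(x : X)‖ ^ 2 ≤ 0 := by nlinarith [hgap.1]
  have h4 : ‖(x : X)‖ = 0 := by nlinarith [norm_nonneg (x : X)]
  exact Subtype.ext (norm_eq_zero.1 h4)

theorem nonnegExcess_self (hB : IsSelfAdjoint B) (hgap : HasSpectralGap B ε) :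
    nonnegExcess (spectralProjection B (Ioi 0)) B = B.ker := by
  rw [← range_spectralProjection_singleton hB hgap.isSpectralSet_singleton]
  ext x
  constructor
  · rintro ⟨h1, h2⟩
    have h1 := (isStarProjection_spectralProjection hgap.isSpectralSet_Ici).mem_range_iff.1 h1
    have h2 : spectralProjection B (Ioi 0) x = 0 := h2
    rw [spectralProjection_Ici_eq hgap] at h1
    change spectralProjection B (Ioi 0) x + spectralProjection B {0} x = x at h1
    rw [h2, zero_add] at h1
    exact ⟨x, h1⟩
  · intro hx
    have h2 := spectralProjection_apply_eq_zero hgap.isSpectralSet_Ioi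
      hgap.isSpectralSet_singleton disjoint_zero_pos.symm hx
    refine ⟨⟨x, ?_⟩, h2⟩
    change spectralProjection B (Ici 0) x = x
    rw [spectralProjection_Ici_eq hgap]
    change spectralProjection B (Ioi 0) x + spectralProjection B {0} x = x
    rw [h2, (isStarProjection_spectralProjection hgap.isSpectralSet_singleton).mem_range_iff.1 hx,
      zero_add]

/-- In the definition of the excess, orthogonality to the range of `π` may be replaced by
orthogonality with respect to the form of `T`: deform `T` to the identity along
`(1 - s) T + s`, which stays coercive. -/
theorem finrank_nonnegExcess_eq {π : X →L[ℂ] X} {δ η : ℝ} (hT : IsSelfAdjoint T)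
    (hgap : HasSpectralGap T η) (hπ : IsStarProjection π) (hδ : 0 < δ)
    (hcoer : ∀ z ∈ π.range, δ * ‖z‖ ^ 2 ≤ (inner ℂ (T z) z).re) :
    Module.finrank ℂ (nonnegExcess π T) = Module.finrank ℂ
      ((spectralProjection T (Ici 0)).range ⊓ (π * T).ker : Submodule ℂ X) := by
  set p := spectralProjection T (Ici 0) with hpdef
  have hp : IsStarProjection p := isStarProjection_spectralProjection hgap.isSpectralSet_Ici
  have hpp : ∀ x, p (p x) = p x := fun x => congr($(hp.isIdempotentElem.eq) x)
  have hcx : ∀ y, T (p y) = p (T y) := fun y => congr($((spectralProjection_commute hT _).eq) y)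
  let Θ : unitInterval → X →L[ℂ] X := fun s => ((1 - s : ℝ) : ℂ) • T + ((s : ℝ) : ℂ) • 1
  have hΘ : Continuous Θ := by
    have h1 : Continuous fun s : unitInterval => ((1 - s : ℝ) : ℂ) :=
      Complex.continuous_ofReal.comp (continuous_const.sub continuous_subtype_val)
    have h2 : Continuous fun s : unitInterval => ((s : ℝ) : ℂ) :=
      Complex.continuous_ofReal.comp continuous_subtype_val
    exact (h1.smul continuous_const).add (h2.smul continuous_const)
  have hsurj : ∀ s, ∀ z ∈ π.range, ∃ x ∈ p.range, π (Θ s x) = z := by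
    intro s
    set δ' := δ / (‖T‖ + 1) with hδ'
    have hT1 : 0 < ‖T‖ + 1 := by positivity
    have hδ'0 : 0 < δ' := by positivity
    obtain ⟨G, hG⟩ := exists_inverse_of_coercive (D := Θ s * p) hπ hδ'0 fun z hz => by
      have h1 := coercive_spectralProjection_Ici hT le_rfl hgap.isSpectralSet_Ici (hcoer z hz)
      rw [zero_mul, sub_zero, ← hpdef] at h1
      have h2 : (inner ℂ (T (p z)) (p z)).re ≤ ‖T‖ * ‖p z‖ ^ 2 := by
        refine (Complex.re_le_norm _).trans ((norm_inner_le_norm _ _).trans ?_)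
        rw [sq, ← mul_assoc]
        gcongr
        exact T.le_opNorm _
      have h3 : δ' * ‖z‖ ^ 2 ≤ ‖p z‖ ^ 2 := by
        rw [hδ', div_mul_eq_mul_div, div_le_iff₀ hT1]
        nlinarith [sq_nonneg ‖p z‖]
      have h4 : δ' * ‖z‖ ^ 2 ≤ (inner ℂ (T (p z)) (p z)).re := by
        refine le_trans ?_ h1
        gcongr
        exact div_le_self hδ.le (by linarith [norm_nonneg T])
      have e : (Θ s * p) z = p (((1 - s : ℝ) : ℂ) • T (p z) + ((s : ℝ) : ℂ) • p z) := by
        rw [map_add, map_smul, map_smul, hpp, ← hcx, hpp]; rfl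
      rw [e, hp.inner_left, inner_add_left, inner_smul_left, inner_smul_left,
        inner_self_eq_norm_sq_to_K, Complex.conj_ofReal, Complex.conj_ofReal, Complex.add_re,
        Complex.re_ofReal_mul, Complex.re_ofReal_mul]
      have e2 : ((((‖p z‖ : ℝ) : ℂ)) ^ 2).re = ‖p z‖ ^ 2 := by norm_cast
      change _ ≤ _ + (s : ℝ) * ((((‖p z‖ : ℝ) : ℂ)) ^ 2).re
      rw [e2]
      nlinarith [mul_le_mul_of_nonneg_left h4 (sub_nonneg.2 s.2.2),
        mul_le_mul_of_nonneg_left h3 s.2.1]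
    intro z hz
    exact ⟨p (G z), ⟨_, rfl⟩, (hG z hz).2⟩
  have h := finrank_range_inf_ker_const hπ.isIdempotentElem (E := fun _ => p) continuous_const hΘ
    (fun _ => hp.isIdempotentElem) hsurj 1 0
  have e1 : Θ 1 = 1 := by simp [Θ]
  have e0 : Θ 0 = T := by simp [Θ]
  rw [e1, e0, mul_one] at h
  exact h

/-- The orthogonal complement, for the form of `A`, of the range of `B`, where `B` is a
compression of `A`. It is a complement of the range of `B`. -/
noncomputable def formComplement (B A : X →L[ℂ] X) : Submodule ℂ X :=
  ((1 - spectralProjection B {0}) * A).ker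

theorem mem_formComplement {x : X} :
    x ∈ formComplement B A ↔ spectralProjection B {0} (A x) = A x := by
  change A x - spectralProjection B {0} (A x) = 0 ↔ _
  rw [sub_eq_zero, eq_comm]

theorem apply_spectralProjection_zero (hB : IsSelfAdjoint B) (hgap : HasSpectralGap B ε) (x : X) :
    B (spectralProjection B {0} x) = 0 := by
  have h : spectralProjection B {0} x ∈ (spectralProjection B {0}).range := ⟨x, rfl⟩
  rw [range_spectralProjection_singleton hB hgap.isSpectralSet_singleton] at h
  exact h

/-- On the range of `B`, `A` acts as `B` modulo the kernel of `B`. -/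
theorem sub_spectralProjection_apply (hB : IsSelfAdjoint B) (hgap : HasSpectralGap B ε)
    (hP : IsStarProjection P) (hPA : P * A * P = B) {x : X} (hx : P x = x) :
    A x - spectralProjection B {0} (A x) = B x := by
  have h1 : ∀ y, P y - spectralProjection B {0} (P y) = y - spectralProjection B {0} y :=
    fun y => congr($((compression_absorb hB hgap hP hPA).2) y)
  have h2 : P (A x) = B x := by
    have e : B x = P (A (P x)) := congr($hPA.symm x)
    rw [e, hx]
  have h3 : spectralProjection B {0} (B x) = 0 := by
    rw [← apply_spectralProjection_zero hB hgap x]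
    exact congr($((spectralProjection_commute hB {0}).eq.symm) x)
  rw [← h1, h2, h3, sub_zero]

theorem eq_zero_of_mem_formComplement (hB : IsSelfAdjoint B) (hgap : HasSpectralGap B ε)
    (hP : IsStarProjection P) (hPA : P * A * P = B) {x : X} (hx : x ∈ formComplement B A)
    (h0 : spectralProjection B {0} x = 0) : x = 0 := by
  have h1 := sub_spectralProjection_apply hB hgap hP hPA (compression_fixed hB hgap hP hPA h0)
  rw [mem_formComplement.1 hx, sub_self] at h1
  have h2 : x ∈ B.ker := h1.symm
  rw [← range_spectralProjection_singleton hB hgap.isSpectralSet_singleton,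
    (isStarProjection_spectralProjection hgap.isSpectralSet_singleton).mem_range_iff, h0] at h2
  exact h2.symm

/-- The form complement is a graph over `ker B`. -/
noncomputable def formComplementEquiv (hB : IsSelfAdjoint B) (hgap : HasSpectralGap B ε)
    (hP : IsStarProjection P) (hPA : P * A * P = B) :
    formComplement B A ≃ₗ[ℂ] (spectralProjection B {0}).range :=
  LinearEquiv.ofBijective
    ((spectralProjection B {0} : X →ₗ[ℂ] X).rangeRestrict.domRestrict (formComplement B A)) <| by
  have hP0 : IsStarProjection (spectralProjection B {0}) :=
    isStarProjection_spectralProjection hgap.isSpectralSet_singleton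
  have hp0 : ∀ x, spectralProjection B {0} (spectralProjection B {0} x)
      = spectralProjection B {0} x := fun x => congr($(hP0.isIdempotentElem.eq) x)
  constructor
  · refine (injective_iff_map_eq_zero _).2 fun x hx => ?_
    have hx : spectralProjection B {0} x = 0 := congrArg Subtype.val hx
    exact Subtype.ext (eq_zero_of_mem_formComplement hB hgap hP hPA x.2 hx)
  · rintro ⟨k, hk⟩
    have hk' := hP0.mem_range_iff.1 hk
    -- `h` solves `B h = A k` modulo the kernel of `B`.
    set u := cfc (fun x : ℝ => x⁻¹) B (A k) with hu
    set h := u - spectralProjection B {0} u with hh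
    have h0 : spectralProjection B {0} h = 0 := by rw [hh, map_sub, hp0, sub_self]
    have hBh : B h = A k - spectralProjection B {0} (A k) := by
      rw [hh, map_sub, apply_spectralProjection_zero hB hgap, sub_zero]
      exact congr($((mul_cfc_inv hB hgap.isSpectralSet_singleton).1) (A k))
    have hAh := sub_spectralProjection_apply hB hgap hP hPA (compression_fixed hB hgap hP hPA h0)
    refine ⟨⟨k - h, ?_⟩, Subtype.ext ?_⟩
    · rw [mem_formComplement, map_sub, map_sub]
      rw [hBh] at hAh
      rw [sub_eq_sub_iff_sub_eq_sub]
      rw [← sub_eq_zero, ← neg_sub (A k), ← neg_sub (A h), hAh]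
      abel
    · change spectralProjection B {0} (k - h) = k
      rw [map_sub, hk', h0, sub_zero]

theorem formComplementEquiv_apply (hB : IsSelfAdjoint B) (hgap : HasSpectralGap B ε)
    (hP : IsStarProjection P) (hPA : P * A * P = B) (r : formComplement B A) :
    (formComplementEquiv hB hgap hP hPA r : X) = spectralProjection B {0} (r : X) := rfl

theorem finiteDimensional_formComplement (hB : IsSelfAdjoint B) (hgap : HasSpectralGap B ε)
    (hP : IsStarProjection P) (hPA : P * A * P = B) (hBk : FiniteDimensional ℂ B.ker) :
    FiniteDimensional ℂ (formComplement B A) := by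
  rw [← range_spectralProjection_singleton hB hgap.isSpectralSet_singleton] at hBk
  exact (formComplementEquiv hB hgap hP hPA).symm.finiteDimensional

theorem finrank_formComplement (hB : IsSelfAdjoint B) (hgap : HasSpectralGap B ε)
    (hP : IsStarProjection P) (hPA : P * A * P = B) :
    Module.finrank ℂ (formComplement B A) = Module.finrank ℂ B.ker := by
  rw [(formComplementEquiv hB hgap hP hPA).finrank_eq,
    range_spectralProjection_singleton hB hgap.isSpectralSet_singleton]

/-- The projection onto the form complement along the range of `B`. -/
noncomputable def formProj (hB : IsSelfAdjoint B) (hgap : HasSpectralGap B ε)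
    (hP : IsStarProjection P) (hPA : P * A * P = B) : X →ₗ[ℂ] formComplement B A :=
  (formComplementEquiv hB hgap hP hPA).symm.toLinearMap ∘ₗ
    (spectralProjection B {0} : X →ₗ[ℂ] X).rangeRestrict

theorem spectralProjection_sub_formProj (hB : IsSelfAdjoint B) (hgap : HasSpectralGap B ε)
    (hP : IsStarProjection P) (hPA : P * A * P = B) (y : X) :
    spectralProjection B {0} (y - formProj hB hgap hP hPA y) = 0 := by
  have h := formComplementEquiv_apply hB hgap hP hPA (formProj hB hgap hP hPA y)
  have h2 : formComplementEquiv hB hgap hP hPA (formProj hB hgap hP hPA y)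
      = (spectralProjection B {0} : X →ₗ[ℂ] X).rangeRestrict y := by
    simp [formProj]
  rw [h2] at h
  have h : spectralProjection B {0} y
    = spectralProjection B {0} (formProj hB hgap hP hPA y : X) := h
  rw [map_sub, h, sub_self]

/-- The form complement is orthogonal to the range of `B` for the form of `A`. -/
theorem inner_formComplement_eq_zero (hgap : HasSpectralGap B ε) {r h : X}
    (hr : r ∈ formComplement B A) (hh : spectralProjection B {0} h = 0) :
    inner ℂ (A r) h = 0 := by
  rw [← mem_formComplement.1 hr,
    (isStarProjection_spectralProjection hgap.isSpectralSet_singleton).inner_left, hh,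
    inner_zero_right]

theorem spectralProjection_Ioi_apply_formComplement (hgap : HasSpectralGap B ε) {r : X}
    (hr : r ∈ formComplement B A) : spectralProjection B (Ioi 0) (A r) = 0 := by
  rw [← mem_formComplement.1 hr]
  exact spectralProjection_apply_eq_zero hgap.isSpectralSet_Ioi hgap.isSpectralSet_singleton
    disjoint_zero_pos.symm ⟨_, rfl⟩

/-- A vector that is nonnegative for `A` and `A`-orthogonal to the positive part of `B` differs
from its projection to the form complement by a vector of the negative part of `B`. -/
theorem re_inner_formProj (hB : IsSelfAdjoint B) (hgap : HasSpectralGap B ε)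
    (hP : IsStarProjection P) (hPA : P * A * P = B) (hA : IsSelfAdjoint A) {η : ℝ}
    (hgapA : HasSpectralGap A η) {y : X}
    (hy : y ∈ ((spectralProjection A (Ici 0)).range ⊓ (spectralProjection B (Ioi 0) * A).ker :
      Submodule ℂ X)) :
    ε * ‖y - formProj hB hgap hP hPA y‖ ^ 2
      ≤ (inner ℂ (A (formProj hB hgap hP hPA y)) (formProj hB hgap hP hPA y : X)).re := by
  set r := formProj hB hgap hP hPA y with hr
  set h := y - (r : X) with hh
  have h0 : spectralProjection B {0} h = 0 := spectralProjection_sub_formProj hB hgap hP hPA y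
  have hPh : P h = h := compression_fixed hB hgap hP hPA h0
  have hBh := sub_spectralProjection_apply hB hgap hP hPA hPh
  have hπAh : spectralProjection B (Ioi 0) (A h) = 0 := by
    have h1 : spectralProjection B (Ioi 0) (A y) = 0 := hy.2
    rw [hh, map_sub, map_sub, h1, spectralProjection_Ioi_apply_formComplement hgap r.2, sub_zero]
  have hπBh : spectralProjection B (Ioi 0) (B h) = 0 := by
    have h1 : spectralProjection B (Ioi 0) (spectralProjection B {0} (A h)) = 0 :=
      spectralProjection_apply_eq_zero hgap.isSpectralSet_Ioi hgap.isSpectralSet_singleton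
        disjoint_zero_pos.symm ⟨_, rfl⟩
    rw [← hBh, map_sub, hπAh, h1, sub_zero]
  have hπh : spectralProjection B (Ioi 0) h = 0 := by
    have h1 : B (spectralProjection B (Ioi 0) h) = 0 := by
      rw [← hπBh]
      exact congr($((spectralProjection_commute hB (Ioi 0)).eq) h)
    have h2 : spectralProjection B (Ioi 0) h ∈ B.ker := h1
    rw [← range_spectralProjection_singleton hB hgap.isSpectralSet_singleton,
      (isStarProjection_spectralProjection hgap.isSpectralSet_singleton).mem_range_iff] at h2
    rw [← h2]
    exact spectralProjection_apply_eq_zero hgap.isSpectralSet_singleton hgap.isSpectralSet_Ioi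
      disjoint_zero_pos ⟨_, rfl⟩
  have hneg := negative_of_compression hB hgap hP hPA (mem_range_Iio_of_eq_zero hB hgap hπh h0)
  have hnn := re_inner_nonneg_of_mem_Ici hA hgapA hy.1
  have o1 : inner ℂ (A r) h = 0 := inner_formComplement_eq_zero hgap r.2 h0
  have o2 : inner ℂ (A h) (r : X) = 0 := by
    rw [inner_map_comm hA, ← inner_conj_symm, o1, map_zero]
  have hyr : y = r + h := by rw [hh]; abel
  rw [hyr, map_add, inner_add_left, inner_add_right, inner_add_right, o1, o2, add_zero, zero_add,
    Complex.add_re] at hnn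
  linarith

theorem finiteDimensional_nonneg_inf (hB : IsSelfAdjoint B) (hgap : HasSpectralGap B ε)
    (hP : IsStarProjection P) (hPA : P * A * P = B) (hBk : FiniteDimensional ℂ B.ker)
    (hA : IsSelfAdjoint A) {η : ℝ} (hgapA : HasSpectralGap A η) :
    FiniteDimensional ℂ ((spectralProjection A (Ici 0)).range
      ⊓ (spectralProjection B (Ioi 0) * A).ker : Submodule ℂ X) := by
  have := finiteDimensional_formComplement hB hgap hP hPA hBk
  refine FiniteDimensional.of_injective ((formProj hB hgap hP hPA).domRestrict _) ?_
  refine (injective_iff_map_eq_zero _).2 fun y hy => ?_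
  have hy : formProj hB hgap hP hPA y = 0 := hy
  have h1 := re_inner_formProj hB hgap hP hPA hA hgapA y.2
  rw [hy, Submodule.coe_zero, sub_zero, inner_zero_right, Complex.zero_re] at h1
  have h3 : ‖(y : X)‖ ^ 2 ≤ 0 := by nlinarith [hgap.1]
  have h4 : ‖(y : X)‖ = 0 := by nlinarith [norm_nonneg (y : X)]
  exact Subtype.ext (norm_eq_zero.1 h4)

/-- Upper bound for the excess by negative subspaces of the form complement. -/
theorem finrank_nonneg_inf_add_le (hB : IsSelfAdjoint B) (hgap : HasSpectralGap B ε)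
    (hP : IsStarProjection P) (hPA : P * A * P = B) (hBk : FiniteDimensional ℂ B.ker)
    (hA : IsSelfAdjoint A) {η : ℝ} (hgapA : HasSpectralGap A η) {V : Submodule ℂ X}
    (hV : V ≤ formComplement B A) (hneg : ∀ x ∈ V, x ≠ 0 → (inner ℂ (A x) x).re < 0) :
    Module.finrank ℂ ((spectralProjection A (Ici 0)).range
      ⊓ (spectralProjection B (Ioi 0) * A).ker : Submodule ℂ X) + Module.finrank ℂ V
      ≤ Module.finrank ℂ (formComplement B A) := by
  have := finiteDimensional_formComplement hB hgap hP hPA hBk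
  have := finiteDimensional_nonneg_inf hB hgap hP hPA hBk hA hgapA
  have : FiniteDimensional ℂ V := Submodule.finiteDimensional_of_le hV
  set Y := ((spectralProjection A (Ici 0)).range
      ⊓ (spectralProjection B (Ioi 0) * A).ker : Submodule ℂ X) with hY
  rw [← Module.finrank_prod]
  refine LinearMap.finrank_le_finrank_of_injective
    (f := ((formProj hB hgap hP hPA).domRestrict Y).coprod (Submodule.inclusion hV)) ?_
  refine (injective_iff_map_eq_zero _).2 ?_
  rintro ⟨y, v⟩ hyv
  have hyv : formProj hB hgap hP hPA y + Submodule.inclusion hV v = 0 := by simpa using hyv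
  have hyv' : (formProj hB hgap hP hPA y : X) = -(v : X) :=
    eq_neg_of_add_eq_zero_left (congrArg Subtype.val hyv)
  have h1 := re_inner_formProj hB hgap hP hPA hA hgapA y.2
  have hpos := mul_nonneg hgap.1.le (sq_nonneg ‖(y : X) - formProj hB hgap hP hPA y‖)
  have hv : (v : X) = 0 := by
    by_contra hv
    have h2 := hneg v v.2 hv
    rw [hyv', map_neg, inner_neg_neg] at h1
    rw [hyv'] at hpos
    linarith
  rw [hyv', hv, neg_zero, sub_zero, inner_zero_right, Complex.zero_re] at h1
  have h3 : ‖(y : X)‖ ^ 2 ≤ 0 := by nlinarith [hgap.1]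
  have h4 : ‖(y : X)‖ = 0 := by nlinarith [norm_nonneg (y : X)]
  exact Prod.ext (Subtype.ext (norm_eq_zero.1 h4)) (Subtype.ext hv)

/-- Lower bound for the excess by nonnegative subspaces of the form complement. -/
theorem finrank_le_nonneg_inf (hB : IsSelfAdjoint B) (hgap : HasSpectralGap B ε)
    (hP : IsStarProjection P) (hPA : P * A * P = B) (hBk : FiniteDimensional ℂ B.ker)
    (hA : IsSelfAdjoint A) {η : ℝ} (hgapA : HasSpectralGap A η) {V : Submodule ℂ X}
    (hV : V ≤ formComplement B A) (hnn : ∀ x ∈ V, 0 ≤ (inner ℂ (A x) x).re) :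
    Module.finrank ℂ V ≤ Module.finrank ℂ ((spectralProjection A (Ici 0)).range
      ⊓ (spectralProjection B (Ioi 0) * A).ker : Submodule ℂ X) := by
  have := finiteDimensional_nonneg_inf hB hgap hP hPA hBk hA hgapA
  set p := spectralProjection A (Ici 0) with hpdef
  set π := spectralProjection B (Ioi 0) with hπdef
  have hπ : IsStarProjection π := isStarProjection_spectralProjection hgap.isSpectralSet_Ioi
  have hp : IsStarProjection p := isStarProjection_spectralProjection hgapA.isSpectralSet_Ici
  have hpp : ∀ x, p (p x) = p x := fun x => congr($(hp.isIdempotentElem.eq) x)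
  have hcx : ∀ y, A (p y) = p (A y) := fun y => congr($((spectralProjection_commute hA _).eq) y)
  have hcoer := coercive_of_compression hB hgap hP hPA
  obtain ⟨G, hG⟩ := exists_inverse_of_coercive (D := A * p) hπ hgap.1 fun z hz => by
    have h1 := coercive_spectralProjection_Ici hA le_rfl hgapA.isSpectralSet_Ici (hcoer z hz)
    rw [zero_mul, sub_zero, ← hpdef, hcx, hp.inner_left, hpp] at h1
    change _ ≤ (inner ℂ (A (p z)) z).re
    rwa [hcx, hp.inner_left]
  -- Correct `v` by a vector of the positive part of `B` and project to the nonnegative part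
  -- of `A`.
  let c : X →L[ℂ] X := 1 - G * π * A * p
  have hc : ∀ v, c v = v - G (π (A (p v))) := fun v => rfl
  let φ : V →ₗ[ℂ] (p.range ⊓ (π * A).ker : Submodule ℂ X) :=
    LinearMap.codRestrict _ (((p * c : X →L[ℂ] X) : X →ₗ[ℂ] X).domRestrict V) fun v => by
      refine ⟨⟨c v, rfl⟩, ?_⟩
      change π (A (p (c v))) = 0
      have h1 : π (A (p (G (π (A (p v)))))) = π (A (p v)) := (hG _ ⟨A (p v), rfl⟩).2
      rw [hc, map_sub, map_sub, map_sub, h1, sub_self]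
  refine LinearMap.finrank_le_finrank_of_injective (f := φ) ?_
  refine (injective_iff_map_eq_zero _).2 fun v hv => ?_
  have hv : p (c v) = 0 := congrArg Subtype.val hv
  set z := G (π (A (p v))) with hz
  have hzπ : z ∈ π.range := (hG _ ⟨A (p v), rfl⟩).1
  have hw : c v ∈ (spectralProjection A (Iio 0)).range := by
    have := spectralProjection_sub_mem hA hgapA.isSpectralSet_Ici (c v)
    rwa [← hpdef, hv, sub_zero, compl_Ici] at this
  have hneg := re_inner_le_neg_gap hA hgapA hw
  have o1 : inner ℂ (A v) z = 0 := by
    rw [← hπ.mem_range_iff.1 hzπ, ← hπ.inner_left,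
      spectralProjection_Ioi_apply_formComplement hgap (hV v.2), inner_zero_left]
  have o2 : inner ℂ (A z) (v : X) = 0 := by
    rw [inner_map_comm hA, ← inner_conj_symm, o1, map_zero]
  have e : inner ℂ (A (c v)) (c v) = inner ℂ (A v) (v : X) + inner ℂ (A z) z := by
    rw [hc, map_sub, inner_sub_left, inner_sub_right, inner_sub_right, o1, o2]; ring
  rw [e, Complex.add_re] at hneg
  have h1 := hnn v v.2
  have h2 := hcoer z hzπ
  have h3 : 0 ≤ ε * ‖z‖ ^ 2 := mul_nonneg hgap.1.le (sq_nonneg _)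
  have h4 : ‖c v‖ ^ 2 ≤ 0 := by nlinarith [hgapA.1]
  have h5 : ‖c v‖ = 0 := by nlinarith [norm_nonneg (c v)]
  have hvz : (v : X) = z := sub_eq_zero.1 (norm_eq_zero.1 h5)
  refine Subtype.ext (eq_zero_of_mem_formComplement hB hgap hP hPA (hV v.2) ?_)
  rw [hvz]
  exact spectralProjection_apply_eq_zero hgap.isSpectralSet_singleton hgap.isSpectralSet_Ioi
    disjoint_zero_pos hzπ

end Compression

/-! ### Forms on finite-dimensional subspaces -/

section FiniteDimensional

variable {X : Type*} [NormedAddCommGroup X] [InnerProductSpace ℂ X]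
  {A : X →L[ℂ] X} {U N R M : Submodule ℂ X}

/-- The kernel of the form of `A` restricted to `U`, as a subspace of `X`. -/
noncomputable def formKerOn (A : X →L[ℂ] X) (U : Submodule ℂ X) : Submodule ℂ X :=
  U ⊓ Uᗮ.comap (A : X →ₗ[ℂ] X)

theorem mem_formKerOn {x : X} :
    x ∈ formKerOn A U ↔ x ∈ U ∧ ∀ y ∈ U, inner ℂ (A x) y = 0 := by
  rw [formKerOn, Submodule.mem_inf, Submodule.mem_comap]
  exact and_congr_right fun _ => Submodule.mem_orthogonal' U (A x)

theorem finrank_add_of_idempotent {p q : U →L[ℂ] U} [FiniteDimensional ℂ U]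
    (hp : IsIdempotentElem p) (hq : IsIdempotentElem q) (hpq : p * q = 0) (hqp : q * p = 0) :
    Module.finrank ℂ (p + q).range = Module.finrank ℂ p.range + Module.finrank ℂ q.range := by
  have h := finrank_range_add_inf_ker (π := (0 : U →L[ℂ] U)) hp hq hpq hqp
    (by rintro _ ⟨y, rfl⟩; exact ⟨0, Submodule.zero_mem _, by simp⟩) inferInstance inferInstance
  have e : ((0 : U →L[ℂ] U) : U →ₗ[ℂ] U).ker = ⊤ := LinearMap.ker_zero
  rwa [e, inf_top_eq, inf_top_eq] at h

/-- The inertia of the form of a self-adjoint operator `A` on a finite-dimensional subspace `U`: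
negative, nonnegative, positive and nonpositive subspaces `V₁`, `V₂`, `V₃`, `V₄` of complementary
dimensions, as in Sylvester's law. -/
theorem exists_inertia (hA : ∀ x y, inner ℂ (A x) y = inner ℂ x (A y)) (U : Submodule ℂ X)
    [FiniteDimensional ℂ U] :
    ∃ V₁ V₂ V₃ V₄ : Submodule ℂ X, (V₁ ≤ U ∧ V₂ ≤ U ∧ V₃ ≤ U ∧ V₄ ≤ U) ∧
      (∀ x ∈ V₁, x ≠ 0 → (inner ℂ (A x) x).re < 0) ∧ (∀ x ∈ V₂, 0 ≤ (inner ℂ (A x) x).re) ∧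
      (∀ x ∈ V₃, x ≠ 0 → 0 < (inner ℂ (A x) x).re) ∧ (∀ x ∈ V₄, (inner ℂ (A x) x).re ≤ 0) ∧
      Module.finrank ℂ V₁ + Module.finrank ℂ V₂ = Module.finrank ℂ U ∧
      Module.finrank ℂ V₃ + Module.finrank ℂ V₄ = Module.finrank ℂ U ∧
      Module.finrank ℂ V₂ = Module.finrank ℂ V₃ + Module.finrank ℂ (formKerOn A U) := by
  let S : U →L[ℂ] U := U.orthogonalProjectionOnto ∘L A ∘L U.subtypeL
  have hS : ∀ x y : U, inner ℂ (S x) y = inner ℂ (A x) (y : X) := fun x y =>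
    Submodule.inner_orthogonalProjectionOnto_eq_of_mem_right y (A x)
  have hSsa : IsSelfAdjoint S := ContinuousLinearMap.isSelfAdjoint_iff_isSymmetric.2 fun x y => by
    change inner ℂ (S x) y = inner ℂ x (S y)
    rw [hS, ← inner_conj_symm x, hS, inner_conj_symm, hA]
  have hSF : S.IsFredholm := ContinuousLinearMap.IsFredholm.of_isQuasiInverse (v := 0) ⟨
    LinearMap.FiniteRangeSetoid.equiv_iff_hasFiniteRange.2 (by simp),
    LinearMap.FiniteRangeSetoid.equiv_iff_hasFiniteRange.2 (by simp)⟩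
  obtain ⟨ε, hgap⟩ := exists_hasSpectralGap hSsa hSF
  have h0 := hgap.isSpectralSet_singleton
  have hm := hgap.isSpectralSet_Iio
  have hp := hgap.isSpectralSet_Ioi
  have hnn := hgap.isSpectralSet_Ici
  have hnp : IsSpectralSet S (Iic 0) := by simpa using hp.compl
  have hneg : ∀ x ∈ (spectralProjection S (Iio 0)).range, x ≠ 0 → (inner ℂ (S x) x).re < 0 := by
    intro x hx hx0
    have h1 := re_inner_le_neg_gap hSsa hgap hx
    have h2 : 0 < ‖x‖ ^ 2 := by positivity
    nlinarith [hgap.1]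
  have hpos : ∀ x ∈ (spectralProjection S (Ioi 0)).range, x ≠ 0 → 0 < (inner ℂ (S x) x).re := by
    intro x hx hx0
    have h1 := coercive_of_compression (P := 1) (T := S) hSsa hgap (.one _) (by simp) x hx
    have h2 : 0 < ‖x‖ ^ 2 := by positivity
    nlinarith [hgap.1]
  have hcount : ∀ {S₁ S₂ : Set ℝ}, IsSpectralSet S S₁ → IsSpectralSet S S₂ → Disjoint S₁ S₂ →
      Module.finrank ℂ (spectralProjection S (S₁ ∪ S₂)).range
        = Module.finrank ℂ (spectralProjection S S₁).range
          + Module.finrank ℂ (spectralProjection S S₂).range := by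
    intro S₁ S₂ h1 h2 hd
    rw [← spectralProjection_add h1 h2 hd]
    refine finrank_add_of_idempotent (isStarProjection_spectralProjection h1).isIdempotentElem
      (isStarProjection_spectralProjection h2).isIdempotentElem ?_ ?_
    · rw [spectralProjection_mul h1 h2, hd.inter_eq, spectralProjection_empty]
    · rw [spectralProjection_mul h2 h1, hd.symm.inter_eq, spectralProjection_empty]
  have huniv : Module.finrank ℂ (spectralProjection S univ).range = Module.finrank ℂ U := by
    have e : spectralProjection S univ = 1 := by
      have := spectralProjection_compl hSsa hm
      have h := spectralProjection_add hm hm.compl disjoint_compl_right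
      rw [union_compl_self, this, add_sub_cancel] at h
      exact h.symm
    rw [e]
    exact LinearMap.finrank_range_of_inj (f := (LinearMap.id : U →ₗ[ℂ] U)) Function.injective_id
  have hle : ∀ V : Submodule ℂ U, V.map U.subtype ≤ U := fun V => Submodule.map_subtype_le U V
  refine ⟨(spectralProjection S (Iio 0)).range.map U.subtype,
    (spectralProjection S (Ici 0)).range.map U.subtype,
    (spectralProjection S (Ioi 0)).range.map U.subtype,
    (spectralProjection S (Iic 0)).range.map U.subtype, ⟨hle _, hle _, hle _, hle _⟩,
    ?_, ?_, ?_, ?_, ?_, ?_, ?_⟩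
  · rintro _ ⟨x, hx, rfl⟩ hx0
    have := hneg x hx fun h => hx0 (by simp [h])
    rwa [hS] at this
  · rintro _ ⟨x, hx, rfl⟩
    have := re_inner_nonneg_of_mem_Ici hSsa hgap hx
    rwa [hS] at this
  · rintro _ ⟨x, hx, rfl⟩ hx0
    have := hpos x hx fun h => hx0 (by simp [h])
    rwa [hS] at this
  · rintro _ ⟨x, hx, rfl⟩
    have := re_inner_le_of_mem_range hSsa hnp (c := 0) (fun _ _ h => h) hx
    rwa [hS, zero_mul] at this
  · rw [Submodule.finrank_map_subtype_eq, Submodule.finrank_map_subtype_eq, ← huniv,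
      ← Iio_union_Ici (a := (0 : ℝ)), hcount hm hnn (by simp [Set.disjoint_left])]
  · rw [Submodule.finrank_map_subtype_eq, Submodule.finrank_map_subtype_eq, ← huniv,
      ← Iic_union_Ioi (a := (0 : ℝ)), hcount hnp hp (by simp [Set.disjoint_left]), add_comm]
  · have e : formKerOn A U = S.ker.map U.subtype := by
      ext x
      rw [mem_formKerOn]
      constructor
      · rintro ⟨hx, hxU⟩
        refine ⟨⟨x, hx⟩, ?_, rfl⟩
        refine ext_inner_right ℂ fun y => ?_
        rw [inner_zero_left]
        exact (hS _ _).trans (hxU y y.2)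
      · rintro ⟨x, hx, rfl⟩
        refine ⟨x.2, fun y hy => ?_⟩
        have hx : S x = 0 := hx
        have := hS x ⟨y, hy⟩
        rw [hx, inner_zero_left] at this
        exact this.symm
    rw [e, Submodule.finrank_map_subtype_eq, Submodule.finrank_map_subtype_eq,
      Submodule.finrank_map_subtype_eq, ← range_spectralProjection_singleton hSsa h0,
      ← hcount hp h0 disjoint_zero_pos.symm, Ioi_union_left]

theorem finrank_add_le_of_disjoint [FiniteDimensional ℂ U] {V W : Submodule ℂ X} (hV : V ≤ U)
    (hW : W ≤ U) (hd : ∀ x ∈ V, x ∈ W → x = 0) :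
    Module.finrank ℂ V + Module.finrank ℂ W ≤ Module.finrank ℂ U := by
  have := Submodule.finiteDimensional_of_le hV
  have := Submodule.finiteDimensional_of_le hW
  have h := Submodule.finrank_sup_add_finrank_inf_eq V W
  have hinf : V ⊓ W = ⊥ := (Submodule.eq_bot_iff _).2 fun x hx => hd x hx.1 hx.2
  rw [hinf, finrank_bot, add_zero] at h
  rw [← h]
  exact Submodule.finrank_mono (sup_le hV hW)

theorem finrank_le_inf_add [FiniteDimensional ℂ R] {V : Submodule ℂ X} (hV : V ≤ R) (hN : N ≤ R) :
    Module.finrank ℂ V + Module.finrank ℂ N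
      ≤ Module.finrank ℂ (V ⊓ N : Submodule ℂ X) + Module.finrank ℂ R := by
  have := Submodule.finiteDimensional_of_le hV
  have := Submodule.finiteDimensional_of_le hN
  have h := Submodule.finrank_sup_add_finrank_inf_eq V N
  have := Submodule.finrank_mono (sup_le hV hN)
  omega

/-- Passing from `R` to the form complement `N` in `R` of an isotropic subspace `M` enlarges the
kernel of the form by the codimension of `N`. -/
theorem finrank_formKerOn_add (hA : ∀ x y, inner ℂ (A x) y = inner ℂ x (A y))
    [FiniteDimensional ℂ R] (hM : M ≤ R) (hiso : ∀ x ∈ M, ∀ y ∈ M, inner ℂ (A x) y = 0)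
    (hN : ∀ x, x ∈ N ↔ x ∈ R ∧ ∀ y ∈ M, inner ℂ (A x) y = 0) :
    Module.finrank ℂ (formKerOn A N) + Module.finrank ℂ N
      = Module.finrank ℂ (formKerOn A R) + Module.finrank ℂ R := by
  have hNR : N ≤ R := fun x hx => ((hN x).1 hx).1
  have hMN : M ≤ N := fun x hx => (hN x).2 ⟨hM hx, hiso x hx⟩
  let J : X →ₗ[ℂ] X := ((R.starProjection ∘L A : X →L[ℂ] X) : X →ₗ[ℂ] X)
  have hJR : ∀ x, J x ∈ R := fun x => R.starProjection_apply_mem (A x)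
  have hJ : ∀ x, ∀ y ∈ R, inner ℂ (J x) y = inner ℂ (A x) y := fun x y hy => by
    change inner ℂ (R.starProjection (A x)) y = _
    rw [Submodule.inner_starProjection_left_eq_right, Submodule.starProjection_eq_self_iff.2 hy]
  have hKN : formKerOn A N ≤ N := inf_le_left
  have hKle : formKerOn A R ≤ formKerOn A N := fun x hx => by
    have hx := mem_formKerOn.1 hx
    exact mem_formKerOn.2 ⟨(hN x).2 ⟨hx.1, fun y hy => hx.2 y (hM hy)⟩,
      fun y hy => hx.2 y (hNR hy)⟩
  have hMK : M ≤ formKerOn A N := fun x hx => mem_formKerOn.2 ⟨hMN hx, fun y hy => by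
    rw [hA, ← inner_conj_symm, ((hN y).1 hy).2 x hx, map_zero]⟩
  have : FiniteDimensional ℂ N := Submodule.finiteDimensional_of_le hNR
  have : FiniteDimensional ℂ (formKerOn A N) := Submodule.finiteDimensional_of_le hKN
  -- The image of the kernel of the form on `N` is the orthogonal complement of `N` in `R`.
  have h1 : (formKerOn A N).map J ≤ Nᗮ ⊓ R := by
    rintro _ ⟨x, hx, rfl⟩
    refine ⟨(Submodule.mem_orthogonal' _ _).2 fun y hy => ?_, hJR x⟩
    rw [hJ x y (hNR hy)]
    exact (mem_formKerOn.1 hx).2 y hy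
  have h2 : (M.map J)ᗮ ⊓ R = N := by
    ext x
    rw [hN, Submodule.mem_inf, and_comm]
    refine and_congr_right fun hx => ?_
    constructor
    · intro h y hy
      have := h (J y) ⟨y, hy, rfl⟩
      rw [hJ y x hx] at this
      rw [hA, ← inner_conj_symm, this, map_zero]
    · rintro h _ ⟨y, hy, rfl⟩
      rw [hJ y x hx, hA, ← inner_conj_symm, h y hy, map_zero]
  have h3 : M.map J ≤ R := by
    rintro _ ⟨x, _, rfl⟩
    exact hJR x
  have c1 := Submodule.finrank_add_inf_finrank_orthogonal h3
  rw [h2] at c1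
  have c2 := Submodule.finrank_add_inf_finrank_orthogonal hNR
  have : FiniteDimensional ℂ (Nᗮ ⊓ R : Submodule ℂ X) :=
    Submodule.finiteDimensional_of_le inf_le_right
  have c3 := Submodule.finrank_mono h1
  have : FiniteDimensional ℂ ((formKerOn A N).map J) := Submodule.finiteDimensional_of_le h1
  have c4 := Submodule.finrank_mono (Submodule.map_mono (f := J) hMK)
  have c5 := (J.domRestrict (formKerOn A N)).finrank_range_add_finrank_ker
  have e : (J.domRestrict (formKerOn A N)).ker
      = (formKerOn A R).comap (formKerOn A N).subtype := by
    ext ⟨x, hx⟩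
    rw [Submodule.mem_comap]
    change J x = 0 ↔ x ∈ formKerOn A R
    rw [mem_formKerOn]
    constructor
    · intro h
      refine ⟨hNR (hKN hx), fun y hy => ?_⟩
      rw [← hJ x y hy, h, inner_zero_left]
    · rintro ⟨_, h⟩
      have : inner ℂ (J x) (J x) = (0 : ℂ) := by rw [hJ x _ (hJR x), h _ (hJR x)]
      exact inner_self_eq_zero.1 this
  rw [LinearMap.range_domRestrict, e,
    (Submodule.comapSubtypeEquivOfLe hKle).finrank_eq] at c5
  omega

/-- The Morse index of a restricted form is the dimension of any negative subspace that has a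
complementary nonnegative subspace. -/
theorem morseIndex_restrictForm [FiniteDimensional ℂ N] {V W : Submodule ℂ X} (hV : V ≤ N)
    (hW : W ≤ N) (hneg : ∀ x ∈ V, x ≠ 0 → (inner ℂ (A x) x).re < 0)
    (hnn : ∀ x ∈ W, 0 ≤ (inner ℂ (A x) x).re)
    (hdim : Module.finrank ℂ V + Module.finrank ℂ W = Module.finrank ℂ N) :
    morseIndex (restrictForm (operatorForm A) N) = Module.finrank ℂ V := by
  refine le_antisymm ?_ ?_
  · refine iSup_le fun V' => iSup_le fun _ => iSup_le fun hV' => ?_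
    have h := finrank_add_le_of_disjoint (V := V'.map N.subtype)
        (Submodule.map_subtype_le N V') hW <| by
      rintro _ ⟨x, hx, rfl⟩ hxW
      by_contra hx0
      have h1 := hV' x hx fun h => hx0 (by simp [h])
      exact absurd (hnn _ hxW) (not_le.2 h1)
    rw [Submodule.finrank_map_subtype_eq] at h
    exact_mod_cast (by omega : Module.finrank ℂ V' ≤ Module.finrank ℂ V)
  · have e := (Submodule.comapSubtypeEquivOfLe hV).finrank_eq
    rw [← e]
    refine le_iSup_of_le (V.comap N.subtype) (le_iSup_of_le inferInstance
      (le_iSup_of_le (fun x hx hx0 => ?_) le_rfl))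
    exact hneg x hx fun h => hx0 (Subtype.ext h)

theorem finrank_formKer_restrictForm :
    Module.finrank ℂ (formKer (restrictForm (operatorForm A) N))
      = Module.finrank ℂ (formKerOn A N) := by
  have hle : formKerOn A N ≤ N := inf_le_left
  have e : formKer (restrictForm (operatorForm A) N) = (formKerOn A N).comap N.subtype := by
    ext x
    rw [mem_formKer, Submodule.mem_comap, Submodule.subtype_apply, mem_formKerOn]
    exact ⟨fun h => ⟨x.2, fun y hy => h ⟨y, hy⟩⟩, fun h y => h.2 y y.2⟩
  rw [e, (Submodule.comapSubtypeEquivOfLe hle).finrank_eq]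

theorem formKer_operatorForm : formKer (operatorForm A) = A.ker := by
  ext x
  rw [mem_formKer]
  refine ⟨fun h => inner_self_eq_zero.1 (h (A x)), fun h y => ?_⟩
  rw [operatorForm_apply, show A x = 0 from h, inner_zero_left]

end FiniteDimensional

/-! ### The relative Morse index of a compression -/

section RelativeMorseIndex

variable {X : Type*} [NormedAddCommGroup X] [InnerProductSpace ℂ X]

open LinearMap.FiniteRangeSetoid in
/-- The Fredholm property is stable under perturbations of finite rank. -/
theorem isFredholm_of_finiteDimensional_sub {T T' : X →L[ℂ] X} (hT : T.IsFredholm)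
    (h : FiniteDimensional ℂ (T' - T).range) : T'.IsFredholm := by
  obtain ⟨v, hv1, hv2⟩ := hT.exists_isQuasiInverse
  have e : (T' : X →ₗ[ℂ] X) ≈ T :=
    equiv_iff_hasFiniteRange.2 ((Submodule.fg_iff_finiteDimensional _).2 h)
  exact .of_isQuasiInverse (v := v)
    ⟨Setoid.trans (equiv_comp_left e) hv1, Setoid.trans (equiv_comp_right e) hv2⟩

theorem isCompactOperator_of_finiteDimensional_range {T : X →L[ℂ] X}
    (h : FiniteDimensional ℂ T.range) : IsCompactOperator T := by
  have : ProperSpace T.range := FiniteDimensional.proper ℂ _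
  let T' : X →L[ℂ] T.range := T.codRestrict T.range fun x => ⟨x, rfl⟩
  have h1 : IsCompactOperator T' := isCompactOperator_of_locallyCompactSpace_dom T'
  exact h1.clm_comp T.range.subtypeL

variable {A P : X →L[ℂ] X}

/-- `A - P A P` has finite rank when `P` has a finite-dimensional kernel. -/
theorem finiteDimensional_range_sub_compression (hP : IsIdempotentElem P)
    (hPker : FiniteDimensional ℂ P.ker) : FiniteDimensional ℂ (A - P * A * P).range := by
  have hPP : ∀ x, P (P x) = P x := fun x => congr($(hP.eq) x)
  have hle : (A - P * A * P).range ≤ P.ker ⊔ P.ker.map (A : X →ₗ[ℂ] X) := by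
    rintro _ ⟨x, rfl⟩
    have e : (A - P * A * P) x = (A (P x) - P (A (P x))) + A (x - P x) := by
      change A x - P (A (P x)) = _
      rw [map_sub]; abel
    change (A - P * A * P) x ∈ _
    rw [e]
    refine Submodule.add_mem_sup ?_ ⟨x - P x, ?_, rfl⟩
    · change P (A (P x) - P (A (P x))) = 0
      rw [map_sub, hPP, sub_self]
    · change P (x - P x) = 0
      rw [map_sub, hPP, sub_self]
  exact Submodule.finiteDimensional_of_le hle

variable [CompleteSpace X]

/-- The segment from the compression `P A P` to `A` has a spectral flow, which is computed by the
negative index of `A` on the form complement of the range of `P A P`. -/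
theorem hasRelativeMorseIndex_compression (hA : IsSelfAdjoint A) (hAF : A.IsFredholm)
    (hP : IsStarProjection P) (hPker : FiniteDimensional ℂ P.ker) {ε : ℝ}
    (hgap : HasSpectralGap (P * A * P) ε) {V W : Submodule ℂ X}
    (hV : V ≤ formComplement (P * A * P) A) (hW : W ≤ formComplement (P * A * P) A)
    (hneg : ∀ x ∈ V, x ≠ 0 → (inner ℂ (A x) x).re < 0)
    (hnn : ∀ x ∈ W, 0 ≤ (inner ℂ (A x) x).re)
    (hdim : Module.finrank ℂ V + Module.finrank ℂ W
      = Module.finrank ℂ (formComplement (P * A * P) A)) :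
    HasRelativeMorseIndex (P * A * P) A (Module.finrank ℂ V) := by
  set B := P * A * P with hBdef
  have hPP : P * P = P := hP.isIdempotentElem.eq
  have hB : IsSelfAdjoint B := by
    have := hA.conjugate P
    rwa [hP.isSelfAdjoint.star_eq] at this
  have hK := finiteDimensional_range_sub_compression (A := A) hP.isIdempotentElem hPker
  rw [← hBdef] at hK
  set C : ℝ → X →L[ℂ] X := fun s => B + (s : ℂ) • (A - B) with hC
  have hC0 : C 0 = B := by simp [hC]
  have hC1 : C 1 = A := by simp [hC]
  have hsa : ∀ t, IsSelfAdjoint (C t) := fun t => by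
    refine hB.add (IsSelfAdjoint.smul ?_ (hA.sub hB))
    exact Complex.conj_ofReal t
  have hcont : Continuous C := by
    have h1 : Continuous fun s : ℝ => (s : ℂ) := Complex.continuous_ofReal
    exact continuous_const.add (h1.smul continuous_const)
  have hF : ∀ t, (C t).IsFredholm := fun t => by
    refine isFredholm_of_finiteDimensional_sub hAF ?_
    refine Submodule.finiteDimensional_of_le (S₂ := (A - B).range) ?_
    rintro _ ⟨x, rfl⟩
    refine ⟨((t : ℂ) - 1) • x, ?_⟩
    change (A - B) (((t : ℂ) - 1) • x) = (B x + (t : ℂ) • (A - B) x) - A x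
    rw [map_smul, sub_smul, one_smul]
    change (t : ℂ) • (A - B) x - (A x - B x) = _
    abel
  have hPC : ∀ t, P * C t * P = B := fun t => by
    have hPB : P * B * P = B := by
      rw [hBdef]
      calc P * (P * A * P) * P = (P * P) * A * (P * P) := by noncomm_ring
        _ = _ := by rw [hPP]
    have h1 : P * (A - B) * P = 0 := by rw [mul_sub, sub_mul, hPB, ← hBdef, sub_self]
    rw [hC]
    change P * (B + (t : ℂ) • (A - B)) * P = B
    rw [mul_add, add_mul, hPB, mul_smul_comm, smul_mul_assoc, h1, smul_zero, add_zero]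
  have hBk : FiniteDimensional ℂ B.ker := hC0 ▸ (hF 0).finite_ker
  have hπ := isStarProjection_spectralProjection hgap.isSpectralSet_Ioi
  obtain ⟨η, hgapA⟩ := exists_hasSpectralGap hA hAF
  refine ⟨isCompactOperator_of_finiteDimensional_range hK, hcont.continuousOn, fun t _ => hsa t,
    fun t _ => hF t, nonempty_spectralSubdivision hcont.continuousOn (fun t _ => hsa t)
      fun t _ => hF t, fun D => ?_⟩
  rw [flow_eq_finrank_nonnegExcess hπ hgap.1 hcont.continuousOn (fun t _ => hsa t)
    (fun t _ => exists_hasSpectralGap (hsa t) (hF t))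
    (fun t _ => coercive_of_compression hB hgap hP (hPC t))
    (fun t _ => by
      obtain ⟨ε', h'⟩ := exists_hasSpectralGap (hsa t) (hF t)
      exact finiteDimensional_nonnegExcess hB hgap hP (hPC t) hBk (hsa t) h') D,
    hC0, hC1, nonnegExcess_self hB hgap,
    finrank_nonnegExcess_eq hA hgapA hπ hgap.1 (coercive_of_compression hB hgap hP hBdef.symm)]
  have h1 := finrank_nonneg_inf_add_le hB hgap hP hBdef.symm hBk hA hgapA hV hneg
  have h2 := finrank_le_nonneg_inf hB hgap hP hBdef.symm hBk hA hgapA hW hnn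
  have h3 := finrank_formComplement hB hgap hP hBdef.symm
  omega

end RelativeMorseIndex

theorem proposition3p3 {X : Type*} [NormedAddCommGroup X] [InnerProductSpace ℂ X]
    [CompleteSpace X] (A P : X →L[ℂ] X) (hA : IsSelfAdjoint A) (hAF : A.IsFredholm)
    (hP : IsStarProjection P) (hPker : FiniteDimensional ℂ P.ker)
    (N : Submodule ℂ X)
    (hN : ∀ x, x ∈ N ↔ ∀ y ∈ P.range, operatorForm A x y = 0) :
    FiniteDimensional ℂ N ∧ FiniteDimensional ℂ (formKer (operatorForm A)) ∧
      ∃ m : ℕ, morseIndex (restrictForm (operatorForm A) N) = m ∧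
        HasRelativeMorseIndex (P * A * P) A
          ((m : ℤ) + (Module.finrank ℂ (formKer (restrictForm (operatorForm A) N)) : ℤ)
            - (Module.finrank ℂ (formKer (operatorForm A)) : ℤ)) := by
  set B := P * A * P with hBdef
  have hB : IsSelfAdjoint B := by
    have := hA.conjugate P
    rwa [hP.isSelfAdjoint.star_eq] at this
  have hK := finiteDimensional_range_sub_compression (A := A) hP.isIdempotentElem hPker
  have hBF : B.IsFredholm := isFredholm_of_finiteDimensional_sub hAF <| by
    have e : (B - A).range = (A - B).range := by
      rw [← neg_sub A B]
      exact LinearMap.range_neg _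
    rw [e]; exact hK
  obtain ⟨ε, hgap⟩ := exists_hasSpectralGap hB hBF
  have hP0 := isStarProjection_spectralProjection hgap.isSpectralSet_singleton
  have hp0 : ∀ y, spectralProjection B {0} (y - spectralProjection B {0} y) = 0 := fun y => by
    rw [map_sub, sub_eq_zero]
    exact congr($(hP0.isIdempotentElem.eq.symm) y)
  set R := formComplement B A with hR
  have hRfin : FiniteDimensional ℂ R :=
    finiteDimensional_formComplement hB hgap hP hBdef.symm hBF.finite_ker
  -- The kernel of `B` inside the range of `P` is isotropic and cuts out `N` in `R`.
  set M := (spectralProjection B {0}).range ⊓ P.range with hM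
  have hMiso : ∀ x ∈ M, ∀ y ∈ M, inner ℂ (A x) y = 0 := fun x hx y hy => by
    rw [inner_compression hP hBdef.symm (hP.mem_range_iff.1 hx.2) (hP.mem_range_iff.1 hy.2),
      ← hP0.mem_range_iff.1 hx.1, apply_spectralProjection_zero hB hgap, inner_zero_left]
  have hMR : M ≤ R := fun x hx => by
    have h := sub_spectralProjection_apply hB hgap hP hBdef.symm (hP.mem_range_iff.1 hx.2)
    rw [← hP0.mem_range_iff.1 hx.1, apply_spectralProjection_zero hB hgap,
      hP0.mem_range_iff.1 hx.1] at h
    exact mem_formComplement.2 (sub_eq_zero.1 h).symm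
  have hcompl : ∀ y, y - spectralProjection B {0} y ∈ P.range := fun y =>
    hP.mem_range_iff.2 <| compression_fixed hB hgap hP hBdef.symm (hp0 y)
  have hNR : ∀ x, x ∈ N ↔ x ∈ R ∧ ∀ y ∈ M, inner ℂ (A x) y = 0 := by
    intro x
    rw [hN]
    constructor
    · intro h
      refine ⟨mem_formComplement.2 (sub_eq_zero.1 ?_).symm, fun y hy => h y hy.2⟩
      refine ext_inner_right ℂ fun y => ?_
      rw [inner_zero_left, inner_sub_left, hP0.inner_left, ← inner_sub_right]
      exact h _ (hcompl y)
    · rintro ⟨hxR, hxM⟩ y hy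
      have h1 : spectralProjection B {0} y ∈ M := ⟨⟨y, rfl⟩, by
        have := P.range.sub_mem hy (hcompl y)
        rwa [sub_sub_cancel] at this⟩
      have h2 := inner_formComplement_eq_zero hgap hxR (hp0 y)
      rw [inner_sub_right, hxM _ h1, sub_zero] at h2
      exact h2
  have hNleR : N ≤ R := fun x hx => ((hNR x).1 hx).1
  have hNfin : FiniteDimensional ℂ N := Submodule.finiteDimensional_of_le hNleR
  have hkerR : formKerOn A R = A.ker := by
    ext x
    rw [mem_formKerOn]
    constructor
    · rintro ⟨hxR, hx⟩
      refine ext_inner_right ℂ fun y => ?_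
      have h1 := hx _ (formProj hB hgap hP hBdef.symm y).2
      have h2 := inner_formComplement_eq_zero hgap hxR
        (spectralProjection_sub_formProj hB hgap hP hBdef.symm y)
      rw [inner_sub_right, h1, sub_zero] at h2
      rw [inner_zero_left]
      exact h2
    · intro hx
      have hx : A x = 0 := hx
      exact ⟨mem_formComplement.2 (by rw [hx, map_zero]), fun y _ => by rw [hx, inner_zero_left]⟩
  have hsymm : ∀ x y, inner ℂ (A x) y = inner ℂ x (A y) := inner_map_comm hA
  have hker := finrank_formKerOn_add hsymm hMR hMiso hNR
  rw [hkerR] at hker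
  obtain ⟨R₁, R₂, R₃, R₄, ⟨hR₁, hR₂, hR₃, hR₄⟩, r₁, r₂, r₃, r₄, cR, cR', cR''⟩ :=
    exists_inertia hsymm R
  obtain ⟨N₁, N₂, N₃, N₄, ⟨hN₁, hN₂, hN₃, hN₄⟩, n₁, n₂, n₃, n₄, cN, cN', cN''⟩ :=
    exists_inertia hsymm N
  rw [hkerR] at cR''
  -- The negative, and likewise the positive, index drops by at most the codimension of `N`.
  have i₁ := finrank_le_inf_add hR₁ hNleR
  have i₂ := finrank_add_le_of_disjoint (V := R₁ ⊓ N) inf_le_right hN₂ fun x hx hx' => by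
    by_contra h0
    exact absurd (n₂ x hx') (not_le.2 (r₁ x hx.1 h0))
  have i₃ := finrank_le_inf_add hR₃ hNleR
  have i₄ := finrank_add_le_of_disjoint (V := R₃ ⊓ N) inf_le_right hN₄ fun x hx hx' => by
    by_contra h0
    exact absurd (n₄ x hx') (not_le.2 (r₃ x hx.1 h0))
  refine ⟨hNfin, by rw [formKer_operatorForm]; exact hAF.finite_ker, Module.finrank ℂ N₁,
    morseIndex_restrictForm hN₁ hN₂ n₁ n₂ cN, ?_⟩
  have hmain := hasRelativeMorseIndex_compression hA hAF hP hPker hgap hR₁ hR₂ r₁ r₂ cR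
  rw [finrank_formKer_restrictForm, formKer_operatorForm]
  convert hmain using 1
  omega
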